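/- **Lemma (slowly decaying wave packets).** Points of $\mathbb R^2\times\mathbb R$ are written $(\xi,\tau)$ with $\xi=(\xi^1,\xi^2)$. For $S\subset\mathbb R^2$, a real phase $\phi$ and an amplitude $a$, let $$\mathcal E^{a}_{S}f(\xi,\tau)=\int_S f(x,y)\,e^{-i(\xi^1x+\xi^2y+\tau\phi(x,y))}\,a(x,y)\,dx\,dy ,$$ and write $\mathcal E_S=\mathcal E_S^{1}$. Fix $\alpha\in C_0^\infty(\mathbb R^2)$ and a constant $C_0$. Then there is a constant $C>0$, depending only on $\alpha$ and $C_0$, with the following property. Let $\delta>0$, $\kappa\ge 1$, let $U\subset\mathbb R^2$ be open and bounded, let $U'=\{z:\operatorname{dist}(z,U)<A\delta\}$ for some $A\ge 4$, and let $\phi$ be a smooth real function on $U'$ such that for all $z\in U'$ $$\kappa\le C_0\|H\phi(z)\|,\qquad \|H\phi(z)\|\le C_0\,\kappa ,\qquad |\partial_1^j\partial_2^k\phi(z)|\le C_0\,(\delta\kappa)^{3-k-j}\delta^{-1}\quad (k\le 3,\ j+k\ge 2),\qquad \partial_1^2\phi(z)=0,$$ where $H\phi$ is the Hessian matrix and $\|\cdot\|$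 the operator norm. Let $R\ge 1/\delta$, $\mathcal Y=R\mathbb Z^2$, $\mathcal V=R^{-1}\mathbb Z^2\cap U'$, $\mathcal W=\mathcal Y\times\mathcal V$, and for $w=(\eta,v)\in\mathcal W$ let $$T_w=\{(\xi,\tau):|\xi-\eta+\tau\nabla\phi(v)|\le R,\ |\tau|\le R^2/\kappa\}.$$ Then for every $f\in L^2(U)$ there are functions $p_w$ on $\mathbb R^2\times\mathbb R$ and coefficients $c_w\in\mathbb C$ $(w\in\mathcal W)$ such that $$\mathcal E^{\alpha}_Uf(\xi,\tau)=\sum_{w\in\mathcal W}c_w\,p_w(\xi,\tau)\qquad(\xi\in\mathbb R^2,\ |\tau|\le R^2/\kappa),$$ the series converging unconditionally at every such point, and such that the following hold for all $w=(\eta,v)\in\mathcal W$. * (P1) $p_w=\mathcal E_{U'}\big(\mathcal F^{-1}(p_w(\cdot,0))\big)$ on $\mathbb R^2\times\mathbb R$, where $\mathcal F g(\xi)=\int g(z)e^{-i\xi\cdot z}dz$. * (P2) The inverse Fourier transform of $p_w$ on $\mathbb R^2\times\mathbb R$ (a tempered distribution in $(z,s)$, normalised as in (P1)) is supported in $\{(z,s):|z-v|<2/R\}$.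 If moreover $|\nabla\phi|\le G$ on $U'$, it is supported in the Euclidean ball $B\big((v,\phi(v)),\,2\max(1,G)/R\big)$, that is, in $B((v,\phi(v)),2/R)$ if $|\nabla\phi|\le1$. * (P3) $p_w$ decays away from $T_w$: for all $\xi\in\mathbb R^2$ and $|\tau|\le R^2/\kappa$, $$|p_w(\xi,\tau)|\le C R^{-1}\Big(1+\tfrac{|\xi^1-\eta^1+\tau\partial_1\phi(v)|}{R}\Big)^{-2}\Big(1+\tfrac{|\xi^2-\eta^2+\tau\partial_2\phi(v)|}{R}\Big)^{-2}.$$ Moreover $\|p_w(\cdot,\tau)\|_{L^2(\mathbb R^2)}\le C$ for all $\tau\in\mathbb R$. * (P4) For every finite subset $W\subset\mathcal W$ and every $\tau\in\mathbb R$, $\big\|\sum_{w\in W}p_w(\cdot,\tau)\big\|_{L^2(\mathbb R^2)}\le C\,|W|^{1/2}$. * (P5) $\big(\sum_{w\in\mathcal W}|c_w|^2\big)^{1/2}\le C\,\|f\|_{L^2(U)}$. -/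

import Mathlib

open MeasureTheory Metric Set
open scoped ContDiff SchwartzMap ENNReal

/-- The Euclidean plane `ℝ²`; coordinate `0` is `x` and coordinate `1` is `y`. -/
abbrev Plane : Type := EuclideanSpace ℝ (Fin 2)

/-- The partial derivative `∂_{i+1} g` of a function on the plane. -/
noncomputable def partialDeriv (i : Fin 2) (g : Plane → ℝ) (z : Plane) : ℝ :=
  fderiv ℝ g z (EuclideanSpace.single i 1)

/-- The mixed partial derivative `∂₁^j ∂₂^k g`. -/
noncomputable def mixedPartial (j k : ℕ) (g : Plane → ℝ) : Plane → ℝ :=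
  (partialDeriv 0)^[j] ((partialDeriv 1)^[k] g)

/-- The operator norm of the Hessian of `g` at `z`, viewed as the derivative of `Dg`. -/
noncomputable def hessianNorm (g : Plane → ℝ) (z : Plane) : ℝ :=
  ‖fderiv ℝ (fderiv ℝ g) z‖

/-- The Fourier extension operator over `S` for the phase `φ` and the amplitude `α`:
`∫_S f(x,y) exp(-i(ξ¹ x + ξ² y + τ φ(x,y))) α(x,y) dx dy`. -/
noncomputable def extOp (S : Set Plane) (α : Plane → ℂ) (φ : Plane → ℝ) (f : Plane → ℂ)
    (ξ : Plane) (τ : ℝ) : ℂ :=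
  ∫ z in S, f z * Complex.exp (-(Complex.I * ((ξ 0 * z 0 + ξ 1 * z 1 + τ * φ z : ℝ) : ℂ))) * α z

/-- The inverse Fourier transform on the plane, inverse to `g ↦ ∫ g(z) exp(-i ξ·z) dz`. -/
noncomputable def invFourierPlane (h : Plane → ℂ) (z : Plane) : ℂ :=
  (((2 * Real.pi) ^ 2 : ℝ) : ℂ)⁻¹ *
    ∫ ξ : Plane, h ξ * Complex.exp (Complex.I * ((ξ 0 * z 0 + ξ 1 * z 1 : ℝ) : ℂ))

/-- The inverse Fourier transform of a Schwartz function of three variables `(z, s) ∈ ℝ² × ℝ`,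
evaluated at `(ξ, τ)`, with the same normalisation as `invFourierPlane`. -/
noncomputable def invFourierSchwartz (g : 𝓢(Plane × ℝ, ℂ)) (ξ : Plane) (τ : ℝ) : ℂ :=
  (((2 * Real.pi) ^ 3 : ℝ) : ℂ)⁻¹ *
    ∫ q : Plane × ℝ, g q *
      Complex.exp (Complex.I * ((ξ 0 * q.1 0 + ξ 1 * q.1 1 + τ * q.2 : ℝ) : ℂ))

/-- The inverse Fourier transform of a bounded function `p` on `ℝ² × ℝ` as a tempered
distribution: its value at the test function `g` is the integral of `p` against the inverse
Fourier transform of `g`. -/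
noncomputable def invFourierDist (p : Plane → ℝ → ℂ) (g : 𝓢(Plane × ℝ, ℂ)) : ℂ :=
  ∫ q : Plane × ℝ, p q.1 q.2 * invFourierSchwartz g q.1 q.2

/-- The open Euclidean ball in `ℝ² × ℝ` with centre `(v, s₀)` and radius `r`
(the norm of the product type is not the Euclidean one). -/
def ball3 (v : Plane) (s₀ r : ℝ) : Set (Plane × ℝ) :=
  {q | Real.sqrt (‖q.1 - v‖ ^ 2 + (q.2 - s₀) ^ 2) < r}

/-- The lattice `R ℤ²`. -/
def latticeY (R : ℝ) : Set Plane := {η | ∃ k : Fin 2 → ℤ, ∀ i, η i = R * k i}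

/-- The part of the lattice `R⁻¹ ℤ²` that lies in `S`. -/
def latticeV (R : ℝ) (S : Set Plane) : Set Plane :=
  {v | ∃ k : Fin 2 → ℤ, ∀ i, v i = R⁻¹ * k i} ∩ S

/-- The index set of pairs `w = (η, v)`, with `η ∈ R ℤ²` and `v ∈ R⁻¹ ℤ² ∩ S`. -/
def packetIndex (R : ℝ) (S : Set Plane) : Set (Plane × Plane) := latticeY R ×ˢ latticeV R S

/-- The coordinate `ξⁱ - ηⁱ + τ ∂ᵢφ(v)`, for `w = (η, v)`, of the horizontal displacement of
`(ξ, τ)` from the axis of the tube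
`T_w = {(ξ, τ) : |ξ - η + τ ∇φ(v)| ≤ R, |τ| ≤ R² / κ}`. -/
noncomputable def tubeOffset (φ : Plane → ℝ) (w : Plane × Plane) (ξ : Plane) (τ : ℝ)
    (i : Fin 2) : ℝ :=
  ξ i - w.1 i + τ * partialDeriv i φ w.2

/-! Write `h` for `f α` cut off to `U`, and tile the plane by half-open squares of side `1/R`
centred at the points `v` of the lattice `R⁻¹ ℤ²`. On one tile, expand `h` in a Fourier series on
the concentric square of side `2π/R`; its frequencies are `R k`, which is where the dual lattice `R
ℤ²` comes from. A smooth window equal to one on the tile and supported in a slightly larger square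
may be inserted at no cost. Parseval for the pairing of `h` on the tile with window times phase then
writes the contribution of the tile as a sum of coefficients times extensions of the modulated
windows (`hasSum_packet_cell`). Only finitely many tiles meet the bounded set `U`, so unconditional
convergence follows by a finite sum.

The packets over tiles that miss `U` are set to zero. The other profiles are supported in `U'`,
because `1/R ≤ δ`. Hence (P1) is Fourier inversion at time zero, and (P2) holds because the
space-time transform of an extension is a measure on the graph of the phase over the support of the
profile (`dsupport_extOp_subset`).

The `L²` bounds come from one Bessel inequality (`tsum_boxCoeff_window_le`): Parseval on each
square, and at most four squares overlapping at a point. With indicators of tiles it bounds the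
coefficients, giving (P5). With smooth windows and duality it bounds sums of profiles, giving (P4),
since the phase factor is unimodular and Plancherel makes the `L²` norm independent of time.

For (P3) rescale the square around `v` to unit size, with coordinates `(x, t)`. Since `∂₁²φ = 0`,
the phase is affine in `x`, so the `x`-integral is exactly the Fourier transform of the bump at `a₁
+ Q(t)`, a rapidly decaying quantity. Two integrations by parts in `t` give the other decay factor.
They involve only `∂₂²φ`, `∂₁∂₂φ` and `∂₁∂₂²φ`, whose rescaled multiples by `τ` are bounded when
`|τ| ≤ R²/κ` and `R ≥ 1/δ` (`exists_profile_decay`). -/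

/-! ### Parseval's identity on the unit square -/

section Parseval

open UnitAddTorus ComplexConjugate

/-- Haar measure of total mass one on `ℝ / ℤ`, as in Mathlib's theory of multiple Fourier series. -/
noncomputable local instance unitAddCircleMeasureSpace : MeasureSpace UnitAddCircle :=
  ⟨AddCircle.haarAddCircle⟩

/-- The half-open unit cube centred at the origin. -/
def unitCube : Set (Fin 2 → ℝ) := {x | ∀ i, x i ∈ Ioc (-1 / 2 : ℝ) (-1 / 2 + 1)}

/-- The representative of a point of the torus in the unit cube. -/
noncomputable def torusRep (x : UnitAddTorus (Fin 2)) : Plane :=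
  WithLp.toLp 2 (fun i => ((AddCircle.equivIoc 1 (-1 / 2 : ℝ) (x i) : ℝ)))

/-- The Fourier coefficient over the unit cube of a function on the plane. -/
noncomputable def cubeCoeff (F : Plane → ℂ) (k : Fin 2 → ℤ) : ℂ :=
  ∫ t : Plane, F t * Complex.exp (-(Complex.I * ((2 * Real.pi * (k 0 * t 0 + k 1 * t 1) : ℝ) : ℂ)))

theorem measurableSet_unitCube : MeasurableSet unitCube := by
  have : unitCube = Set.pi univ (fun _ => Ioc (-1 / 2 : ℝ) (-1 / 2 + 1)) := by
    ext x; simp [unitCube]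
  rw [this]
  exact MeasurableSet.univ_pi fun _ => measurableSet_Ioc

/-- This carries square-integrability and integrals between the unit square and the torus, so that
Parseval on the torus applies to functions on the plane. -/
theorem measurePreserving_torusRep :
    MeasurePreserving torusRep volume
      (volume.restrict (WithLp.ofLp (p := 2) ⁻¹' unitCube : Set Plane)) := by
  have h1 := measurePreserving_equivPiIoc (d := Fin 2) (a := fun _ => (-1 / 2 : ℝ))
  have h2 := measurePreserving_subtype_coe (μa := (volume : Measure (Fin 2 → ℝ)))
    measurableSet_unitCube
  have h3 : MeasurePreserving (@WithLp.toLp 2 (Fin 2 → ℝ)) (volume.restrict unitCube)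
      (volume.restrict (WithLp.ofLp (p := 2) ⁻¹' unitCube : Set Plane)) := by
    have := (PiLp.volume_preserving_toLp (Fin 2)).restrict_preimage
      (s := (WithLp.ofLp (p := 2) ⁻¹' unitCube : Set Plane))
      ((PiLp.volume_preserving_ofLp (Fin 2)).measurable measurableSet_unitCube)
    exact this
  exact h3.comp (h2.comp h1)

theorem torusRep_coe {x : Fin 2 → ℝ} (hx : x ∈ unitCube) :
    torusRep (fun i => (x i : UnitAddCircle)) = WithLp.toLp 2 x := by
  unfold torusRep
  congr 1
  funext i
  rw [AddCircle.equivIoc_coe_eq (hx i)]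

theorem mFourier_neg_coe (k : Fin 2 → ℤ) (x : Fin 2 → ℝ) :
    mFourier (-k) (fun i => (x i : UnitAddCircle)) =
      Complex.exp (-(Complex.I * ((2 * Real.pi * (k 0 * x 0 + k 1 * x 1) : ℝ) : ℂ))) := by
  simp only [mFourier, ContinuousMap.coe_mk, Fin.prod_univ_two, Pi.neg_apply, fourier_coe_apply,
    ← Complex.exp_add]
  congr 1
  push_cast
  ring

theorem setIntegral_unitCube {F : Plane → ℂ}
    (hF : ∀ t : Plane, WithLp.ofLp t ∉ unitCube → F t = 0) :
    ∫ x in unitCube, F (WithLp.toLp 2 x) = ∫ t : Plane, F t := by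
  rw [setIntegral_eq_integral_of_forall_compl_eq_zero (fun x hx => hF _ hx)]
  exact (PiLp.volume_preserving_toLp (Fin 2)).integral_comp
    (MeasurableEquiv.toLp 2 (Fin 2 → ℝ)).measurableEmbedding F

theorem mFourierCoeff_torusRep {F : Plane → ℂ}
    (hF : ∀ t : Plane, WithLp.ofLp t ∉ unitCube → F t = 0) (k : Fin 2 → ℤ) :
    mFourierCoeff (fun x => F (torusRep x)) k = cubeCoeff F k := by
  rw [mFourierCoeff_eq_integral _ _ (fun _ => (-1 / 2 : ℝ)), cubeCoeff,
    ← setIntegral_unitCube (fun t ht => by simp [hF t ht])]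
  refine setIntegral_congr_fun measurableSet_unitCube fun x hx => ?_
  simp only [torusRep_coe hx, mFourier_neg_coe, smul_eq_mul]
  rw [mul_comm]

/-- Parseval's identity for two square-integrable functions supported in the unit cube. -/
theorem hasSum_cubeCoeff {F G : Plane → ℂ} (hF : MemLp F 2) (hG : MemLp G 2)
    (hF0 : ∀ t : Plane, WithLp.ofLp t ∉ unitCube → F t = 0)
    (hG0 : ∀ t : Plane, WithLp.ofLp t ∉ unitCube → G t = 0) :
    HasSum (fun k => cubeCoeff F k * cubeCoeff G (-k)) (∫ t, F t * G t) := by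
  have mF : MemLp (fun x => F (torusRep x)) 2 :=
    (hF.restrict _).comp_measurePreserving measurePreserving_torusRep
  have hG' : MemLp (fun t => conj (G t)) 2 := hG.star
  have mG : MemLp (fun x => conj (G (torusRep x))) 2 :=
    (hG'.restrict _).comp_measurePreserving measurePreserving_torusRep
  -- Parseval on the torus is sesquilinear. It is applied to the conjugate of `G`, because the
  -- extension integral pairs two functions without conjugation; this turns `k` into `-k` in the
  -- second factor.
  have key := hasSum_prod_mFourierCoeff (mG.toLp _) (mF.toLp _)
  have e1 : ∀ k, mFourierCoeff (mF.toLp _) k = cubeCoeff F k := fun k => by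
    rw [← mFourierCoeff_torusRep hF0]
    exact integral_congr_ae (ae_eq_rfl.mul mF.coeFn_toLp)
  have e2 : ∀ k, conj (mFourierCoeff (mG.toLp _) k) = cubeCoeff G (-k) := fun k => by
    have : mFourierCoeff (mG.toLp _) k = cubeCoeff (fun t => conj (G t)) k := by
      rw [← mFourierCoeff_torusRep (fun t ht => by simp [hG0 t ht])]
      exact integral_congr_ae (ae_eq_rfl.mul mG.coeFn_toLp)
    rw [this, cubeCoeff, cubeCoeff, ← integral_conj]
    refine integral_congr_ae (ae_of_all _ fun t => ?_)
    simp only [map_mul, Complex.conj_conj, ← Complex.exp_conj, map_neg, Complex.conj_I,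
      Complex.conj_ofReal, Pi.neg_apply]
    congr 2
    push_cast
    ring
  have e3 : ∫ x, conj ((mG.toLp _ : UnitAddTorus (Fin 2) → ℂ) x) *
      (mF.toLp _ : UnitAddTorus (Fin 2) → ℂ) x = ∫ t, F t * G t := by
    have : ∫ x, conj ((mG.toLp _ : UnitAddTorus (Fin 2) → ℂ) x) *
      (mF.toLp _ : UnitAddTorus (Fin 2) → ℂ) x =
        ∫ x, F (torusRep x) * G (torusRep x) := by
      refine integral_congr_ae ?_
      filter_upwards [mG.coeFn_toLp, mF.coeFn_toLp] with x h1 h2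
      rw [h1, h2, Complex.conj_conj, mul_comm]
    rw [this, integral_preimage _ (fun _ => (-1 / 2 : ℝ)),
      ← setIntegral_unitCube (F := fun t => F t * G t) (fun t ht => by simp [hF0 t ht])]
    refine setIntegral_congr_fun measurableSet_unitCube fun x hx => ?_
    simp only [torusRep_coe hx]
  rw [e3] at key
  convert key using 2 with k
  rw [e1, e2, mul_comm]

end Parseval

theorem enorm_sq_eq_ofReal (x : ℂ) :
    ‖x‖ₑ ^ 2 = ENNReal.ofReal (‖x‖ ^ 2) := by
  rw [← ofReal_norm, ENNReal.ofReal_pow (norm_nonneg _)]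

theorem lintegral_enorm_sq {X : Type*} [MeasurableSpace X] {μ : Measure X} {F : X → ℂ}
    (hF : MemLp F 2 μ) : ∫⁻ t, ‖F t‖ₑ ^ 2 ∂μ = ENNReal.ofReal (∫ t, ‖F t‖ ^ 2 ∂μ) := by
  rw [ofReal_integral_eq_lintegral_ofReal ((memLp_two_iff_integrable_sq_norm hF.1).1 hF)
    (ae_of_all _ fun _ => by positivity)]
  exact lintegral_congr fun t => enorm_sq_eq_ofReal _

/-- Parseval's identity for the norm of a function supported in the unit cube. -/
theorem tsum_cubeCoeff {F : Plane → ℂ} (hF : MemLp F 2)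
    (hF0 : ∀ t : Plane, WithLp.ofLp t ∉ unitCube → F t = 0) :
    ∑' k, ‖cubeCoeff F k‖ₑ ^ 2 = ∫⁻ t, ‖F t‖ₑ ^ 2 := by
  have h := hasSum_cubeCoeff (F := F) (G := fun t => star (F t)) hF hF.star hF0
    (fun t ht => by simp [hF0 t ht])
  have e : ∀ k, cubeCoeff (fun t => star (F t)) (-k) = star (cubeCoeff F k) := fun k => by
    have : star (cubeCoeff F k) = (starRingEnd ℂ) (cubeCoeff F k) := rfl
    rw [this, cubeCoeff, cubeCoeff, ← integral_conj]
    refine integral_congr_ae (ae_of_all _ fun t => ?_)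
    simp only [map_mul, ← Complex.exp_conj, map_neg, Complex.conj_I,
      Complex.conj_ofReal, Pi.neg_apply]
    congr 2
    push_cast
    ring
  have h' := Complex.hasSum_re h
  have e4 : (∫ t, F t * star (F t)).re = ∫ t, ‖F t‖ ^ 2 := by
    have : ∀ t, F t * star (F t) = ((‖F t‖ ^ 2 : ℝ) : ℂ) := fun t => by
      simpa using Complex.mul_conj' (F t)
    simp_rw [this]
    rw [integral_complex_ofReal, Complex.ofReal_re]
  have e5 : ∀ k, (cubeCoeff F k * cubeCoeff (fun t => star (F t)) (-k)).re =
      ‖cubeCoeff F k‖ ^ 2 := fun k => by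
    rw [e k]
    have : cubeCoeff F k * star (cubeCoeff F k) = ((‖cubeCoeff F k‖ ^ 2 : ℝ) : ℂ) := by
      simpa using Complex.mul_conj' (cubeCoeff F k)
    rw [this, Complex.ofReal_re]
  rw [e4] at h'
  simp only [e5] at h'
  have h6 := ENNReal.ofReal_tsum_of_nonneg (f := fun k => ‖cubeCoeff F k‖ ^ 2)
    (fun _ => by positivity) h'.summable
  rw [h'.tsum_eq] at h6
  rw [lintegral_enorm_sq hF, h6]
  exact tsum_congr fun k => enorm_sq_eq_ofReal _

/-! ### Rescaling to squares of side 2π/R -/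

/-- The Fourier coefficient of `H` against `exp(i R k·(z - v))`, where `k ∈ ℤ²`. -/
noncomputable def boxCoeff (R : ℝ) (v : Plane) (H : Plane → ℂ) (k : Fin 2 → ℤ) : ℂ :=
  ∫ z : Plane, H z *
    Complex.exp (-(Complex.I * ((R * (k 0 * (z 0 - v 0) + k 1 * (z 1 - v 1)) : ℝ) : ℂ)))

section Dilation

variable {E : Type*} [NormedAddCommGroup E] [InnerProductSpace ℝ E] [FiniteDimensional ℝ E]
  [MeasurableSpace E] [BorelSpace E]

omit [FiniteDimensional ℝ E] in
theorem measurableEmbedding_add_smul {s : ℝ} (hs : 0 < s) (v : E) :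
    MeasurableEmbedding (fun t : E => v + s • t) :=
  ((Homeomorph.smulOfNeZero s hs.ne').trans (Homeomorph.addLeft v)).measurableEmbedding

theorem map_add_smul {s : ℝ} (hs : 0 < s) (v : E) :
    Measure.map (fun t : E => v + s • t) volume =
      ENNReal.ofReal ((s ^ Module.finrank ℝ E)⁻¹) • volume := by
  have h1 : (fun t : E => v + s • t) = (fun z => v + z) ∘ (fun t => s • t) := rfl
  rw [h1, ← Measure.map_map (measurable_const_add v) (measurable_const_smul s),
    Measure.map_addHaar_smul _ hs.ne', Measure.map_smul, map_add_left_eq_self, abs_of_pos]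
  positivity

theorem lintegral_add_smul {s : ℝ} (hs : 0 < s) (v : E) (Φ : E → ℝ≥0∞) :
    ∫⁻ t, Φ (v + s • t) = ENNReal.ofReal ((s ^ Module.finrank ℝ E)⁻¹) * ∫⁻ z, Φ z := by
  rw [← (measurableEmbedding_add_smul hs v).lintegral_map, map_add_smul hs,
    lintegral_smul_measure, smul_eq_mul]

theorem integral_add_smul {s : ℝ} (hs : 0 < s) (v : E) (Φ : E → ℂ) :
    ∫ t, Φ (v + s • t) = (((s ^ Module.finrank ℝ E)⁻¹ : ℝ) : ℂ) * ∫ z, Φ z := by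
  rw [← (measurableEmbedding_add_smul hs v).integral_map (μ := volume), map_add_smul hs,
    integral_smul_measure, ENNReal.toReal_ofReal (by positivity), Complex.real_smul]

theorem MeasureTheory.MemLp.add_smul {s : ℝ} (hs : 0 < s) (v : E) {Φ : E → ℂ} {p : ℝ≥0∞}
    (h : MemLp Φ p) : MemLp (fun t => Φ (v + s • t)) p := by
  have : MemLp Φ p (Measure.map (fun t : E => v + s • t) volume) := by
    rw [map_add_smul hs]
    exact h.smul_measure ENNReal.ofReal_ne_top
  exact this.comp_of_map (measurableEmbedding_add_smul hs v).measurable.aemeasurable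

end Dilation

section Box

variable {R : ℝ} {v : Plane}

/-- The open square with centre `v` and sides of length `2 / R`. -/
def openBox (R : ℝ) (v : Plane) : Set Plane := {z | ∀ i, |R * (z i - v i)| < 1}

theorem boxCoeff_eq_cubeCoeff (hR : 0 < R) (H : Plane → ℂ) (k : Fin 2 → ℤ) :
    boxCoeff R v H k =
      (((2 * Real.pi / R) ^ 2 : ℝ) : ℂ) * cubeCoeff (fun t => H (v + (2 * Real.pi / R) • t)) k := by
  have hs : 0 < 2 * Real.pi / R := by positivity
  have h := integral_add_smul hs v (fun z : Plane => H z *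
    Complex.exp (-(Complex.I * ((R * (k 0 * (z 0 - v 0) + k 1 * (z 1 - v 1)) : ℝ) : ℂ))))
  have e : ∀ t : Plane, R * (k 0 * ((v + (2 * Real.pi / R) • t) 0 - v 0) +
      k 1 * ((v + (2 * Real.pi / R) • t) 1 - v 1)) = 2 * Real.pi * (k 0 * t 0 + k 1 * t 1) := by
    intro t
    simp only [PiLp.add_apply, PiLp.smul_apply, smul_eq_mul]
    field_simp
    ring
  simp only [e] at h
  rw [cubeCoeff, h, boxCoeff, ← mul_assoc, ← Complex.ofReal_mul]
  simp only [finrank_euclideanSpace, Fintype.card_fin]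
  rw [mul_inv_cancel₀ (by positivity), Complex.ofReal_one, one_mul]

/-- A point of the open box has rescaled coordinates below `1/(2π)` in modulus, hence below `1/2`:
the box of side `2/R` fits inside one period square of side `2π/R`. -/
theorem eq_zero_of_notMem_unitCube (hR : 0 < R) {H : Plane → ℂ}
    (hH : ∀ z ∉ openBox R v, H z = 0) (t : Plane) (ht : WithLp.ofLp t ∉ unitCube) :
    H (v + (2 * Real.pi / R) • t) = 0 := by
  refine hH _ fun hz => ht fun i => ?_
  have := hz i
  simp only [PiLp.add_apply, PiLp.smul_apply, smul_eq_mul, add_sub_cancel_left] at this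
  rw [show R * (2 * Real.pi / R * t i) = 2 * Real.pi * t i by field_simp, abs_lt] at this
  have hpi := Real.pi_gt_three
  constructor <;> nlinarith

/-- Each coefficient carries a Jacobian `(2π/R)²`, while the rescaled integral carries its inverse,
so one such factor survives. -/
theorem hasSum_boxCoeff (hR : 0 < R) {H G : Plane → ℂ} (hH : MemLp H 2) (hG : MemLp G 2)
    (hH0 : ∀ z ∉ openBox R v, H z = 0) (hG0 : ∀ z ∉ openBox R v, G z = 0) :
    HasSum (fun k => boxCoeff R v H k * boxCoeff R v G (-k))
      ((((2 * Real.pi / R) ^ 2 : ℝ) : ℂ) * ∫ z, H z * G z) := by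
  have hs : 0 < 2 * Real.pi / R := by positivity
  have h := hasSum_cubeCoeff (hH.add_smul hs v) (hG.add_smul hs v)
    (eq_zero_of_notMem_unitCube hR hH0) (eq_zero_of_notMem_unitCube hR hG0)
  rw [integral_add_smul hs v (fun z => H z * G z)] at h
  have h' := h.mul_left ((((2 * Real.pi / R) ^ 2 : ℝ) : ℂ) * (((2 * Real.pi / R) ^ 2 : ℝ) : ℂ))
  have e1 : (fun k => boxCoeff R v H k * boxCoeff R v G (-k)) = fun k =>
      (((2 * Real.pi / R) ^ 2 : ℝ) : ℂ) * (((2 * Real.pi / R) ^ 2 : ℝ) : ℂ) *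
        (cubeCoeff (fun t => H (v + (2 * Real.pi / R) • t)) k *
          cubeCoeff (fun t => G (v + (2 * Real.pi / R) • t)) (-k)) := by
    funext k
    rw [boxCoeff_eq_cubeCoeff hR, boxCoeff_eq_cubeCoeff hR]
    ring
  have e2 : (((2 * Real.pi / R) ^ 2 : ℝ) : ℂ) * ∫ z, H z * G z =
      (((2 * Real.pi / R) ^ 2 : ℝ) : ℂ) * (((2 * Real.pi / R) ^ 2 : ℝ) : ℂ) *
        ((((2 * Real.pi / R) ^ Module.finrank ℝ Plane)⁻¹ : ℝ) * ∫ z, H z * G z) := by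
    rw [mul_assoc, ← mul_assoc _ _ (∫ z, H z * G z), ← Complex.ofReal_mul]
    simp only [finrank_euclideanSpace, Fintype.card_fin]
    rw [mul_inv_cancel₀ (by positivity), Complex.ofReal_one, one_mul]
  rw [e1, e2]
  exact h'

theorem tsum_boxCoeff (hR : 0 < R) {H : Plane → ℂ} (hH : MemLp H 2)
    (hH0 : ∀ z ∉ openBox R v, H z = 0) :
    ∑' k, ‖boxCoeff R v H k‖ₑ ^ 2 =
      ENNReal.ofReal ((2 * Real.pi / R) ^ 2) * ∫⁻ z, ‖H z‖ₑ ^ 2 := by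
  have hs : 0 < 2 * Real.pi / R := by positivity
  have h := tsum_cubeCoeff (hH.add_smul hs v) (eq_zero_of_notMem_unitCube hR hH0)
  rw [lintegral_add_smul hs v (fun z => ‖H z‖ₑ ^ 2)] at h
  have e : ∀ k, ‖boxCoeff R v H k‖ₑ ^ 2 = ENNReal.ofReal ((2 * Real.pi / R) ^ 2) ^ 2 *
      ‖cubeCoeff (fun t => H (v + (2 * Real.pi / R) • t)) k‖ₑ ^ 2 := fun k => by
    rw [boxCoeff_eq_cubeCoeff hR, enorm_mul, mul_pow]
    congr 2
    rw [← ofReal_norm, Complex.norm_real, Real.norm_of_nonneg (by positivity)]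
  simp_rw [e]
  rw [ENNReal.tsum_mul_left, h, ← mul_assoc]
  congr 1
  simp only [finrank_euclideanSpace, Fintype.card_fin]
  rw [sq, mul_assoc, ← ENNReal.ofReal_mul (by positivity) (q := ((2 * Real.pi / R) ^ 2)⁻¹),
    mul_inv_cancel₀ (by positivity), ENNReal.ofReal_one, mul_one]

end Box

/-! ### The extension operator at a fixed time -/

theorem contDiff_of_forall_mem_tsupport {f : Plane → ℂ} (h : ∀ z ∈ tsupport f, ContDiffAt ℝ ∞ f z) :
    ContDiff ℝ ∞ f := by
  refine contDiff_iff_contDiffAt.2 fun z => ?_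
  by_cases hz : z ∈ tsupport f
  · exact h z hz
  · exact contDiffAt_const.congr_of_eventuallyEq (notMem_tsupport_iff_eventuallyEq.1 hz)

section Extension

open scoped FourierTransform

variable {S : Set Plane} {φ : Plane → ℝ} {g : Plane → ℂ}

/-- The function `g` multiplied by the phase factor `exp(-iτφ)`. -/
noncomputable def phaseMul (φ : Plane → ℝ) (τ : ℝ) (g : Plane → ℂ) (z : Plane) : ℂ :=
  g z * Complex.exp (-(Complex.I * ((τ * φ z : ℝ) : ℂ)))

theorem norm_exp_neg_I_mul (x : ℝ) : ‖Complex.exp (-(Complex.I * (x : ℂ)))‖ = 1 := by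
  rw [Complex.norm_exp]
  simp

theorem norm_phaseMul (τ : ℝ) (z : Plane) : ‖phaseMul φ τ g z‖ = ‖g z‖ := by
  rw [phaseMul, norm_mul, norm_exp_neg_I_mul, mul_one]

/-- The phase is smooth only on `S`, but off the support of `g` the product vanishes locally, so
smoothness has to be checked only on that support. -/
theorem contDiff_phaseMul (hS : IsOpen S) (hφ : ContDiffOn ℝ ∞ φ S) (hg : ContDiff ℝ ∞ g)
    (hgS : tsupport g ⊆ S) (τ : ℝ) : ContDiff ℝ ∞ (phaseMul φ τ g) := by
  refine contDiff_of_forall_mem_tsupport fun z hz => ?_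
  have hz' : z ∈ tsupport g := closure_mono (fun x hx => by
    simp only [Function.mem_support, phaseMul] at hx ⊢
    exact left_ne_zero_of_mul hx) hz
  have h1 : ContDiffAt ℝ ∞ φ z := hφ.contDiffAt (hS.mem_nhds (hgS hz'))
  have h2 : ContDiffAt ℝ ∞ (fun z => ((τ * φ z : ℝ) : ℂ)) z :=
    Complex.ofRealCLM.contDiff.contDiffAt.comp z (contDiffAt_const.mul h1)
  exact hg.contDiffAt.mul (contDiffAt_const.mul h2).neg.cexp

theorem hasCompactSupport_phaseMul (hg : HasCompactSupport g) (τ : ℝ) :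
    HasCompactSupport (phaseMul φ τ g) := hg.mul_right

theorem phaseMul_zero : phaseMul φ 0 g = g := by
  funext z
  simp [phaseMul]

theorem extOp_one_eq_integral (hgS : tsupport g ⊆ S) (ξ : Plane) (τ : ℝ) :
    extOp S (fun _ => 1) φ g ξ τ =
      ∫ z, g z * Complex.exp (-(Complex.I * ((ξ 0 * z 0 + ξ 1 * z 1 + τ * φ z : ℝ) : ℂ))) := by
  rw [extOp]
  simp only [mul_one]
  refine setIntegral_eq_integral_of_forall_compl_eq_zero fun z hz => ?_
  rw [image_eq_zero_of_notMem_tsupport (fun h => hz (hgS h)), zero_mul]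

/-- The factor `(2π)⁻¹` passes from frequency to angular frequency. The summand `0` gives the
argument the shape `v + s • t` of the change of variables lemmas. -/
theorem extOp_one_eq_fourier (hgS : tsupport g ⊆ S) (ξ : Plane) (τ : ℝ) :
    extOp S (fun _ => 1) φ g ξ τ = 𝓕 (phaseMul φ τ g) (0 + (2 * Real.pi)⁻¹ • ξ) := by
  rw [extOp_one_eq_integral hgS, Real.fourier_eq']
  refine integral_congr_ae (ae_of_all _ fun z => ?_)
  simp only [phaseMul, zero_add, smul_eq_mul]
  rw [mul_comm (Complex.exp _) (_ * _), mul_assoc, ← Complex.exp_add]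
  congr 2
  simp only [PiLp.inner_apply, Fin.sum_univ_two, PiLp.smul_apply, smul_eq_mul, RCLike.inner_apply,
    conj_trivial]
  have : -2 * Real.pi * ((2 * Real.pi)⁻¹ * ξ 0 * z 0 + (2 * Real.pi)⁻¹ * ξ 1 * z 1) =
    -(ξ 0 * z 0 + ξ 1 * z 1) := by
    field_simp
  rw [this]
  push_cast
  ring

theorem extOp_integrand_eq (ξ z : Plane) (τ : ℝ) :
    g z * Complex.exp (-(Complex.I * ((ξ 0 * z 0 + ξ 1 * z 1 + τ * φ z : ℝ) : ℂ))) =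
      phaseMul φ τ g z * Complex.exp (-(Complex.I * ((ξ 0 * z 0 + ξ 1 * z 1 : ℝ) : ℂ))) := by
  rw [phaseMul, mul_assoc, ← Complex.exp_add]
  congr 2
  push_cast
  ring

theorem memLp_extOp_integrand (hS : IsOpen S) (hφ : ContDiffOn ℝ ∞ φ S) (hg : ContDiff ℝ ∞ g)
    (hgc : HasCompactSupport g) (hgS : tsupport g ⊆ S) (ξ : Plane) (τ : ℝ) (p : ℝ≥0∞) :
    MemLp (fun z : Plane => g z *
      Complex.exp (-(Complex.I * ((ξ 0 * z 0 + ξ 1 * z 1 + τ * φ z : ℝ) : ℂ)))) p := by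
  simp_rw [extOp_integrand_eq]
  have hc : Continuous fun z : Plane => phaseMul φ τ g z *
      Complex.exp (-(Complex.I * ((ξ 0 * z 0 + ξ 1 * z 1 : ℝ) : ℂ))) :=
    (contDiff_phaseMul hS hφ hg hgS τ).continuous.mul (by fun_prop)
  exact hc.memLp_of_hasCompactSupport (hasCompactSupport_phaseMul hgc τ).mul_right

theorem extOp_one_sum {ι : Type*} (W : Finset ι) {g : ι → Plane → ℂ} (hS : IsOpen S)
    (hφ : ContDiffOn ℝ ∞ φ S) (hg : ∀ w, ContDiff ℝ ∞ (g w)) (hgc : ∀ w, HasCompactSupport (g w))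
    (hgS : ∀ w, tsupport (g w) ⊆ S) (ξ : Plane) (τ : ℝ) :
    ∑ w ∈ W, extOp S (fun _ => 1) φ (g w) ξ τ =
      extOp S (fun _ => 1) φ (fun z => ∑ w ∈ W, g w z) ξ τ := by
  simp only [extOp, mul_one, Finset.sum_mul]
  rw [integral_finsetSum]
  exact fun w _ => (memLp_one_iff_integrable.1
    (memLp_extOp_integrand hS hφ (hg w) (hgc w) (hgS w) ξ τ 1)).integrableOn

/-- Fourier inversion for the initial value of the extension of a test function. -/
theorem invFourierPlane_extOp (hg : ContDiff ℝ ∞ g) (hgc : HasCompactSupport g)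
    (hgS : tsupport g ⊆ S) :
    invFourierPlane (fun ζ => extOp S (fun _ => 1) φ g ζ 0) = g := by
  funext z
  set f : 𝓢(Plane, ℂ) := hgc.toSchwartzMap hg with hf
  have hfg : ⇑f = g := rfl
  have h1 : 𝓕⁻ (𝓕 f) z = g z := by rw [FourierTransform.fourierInv_fourier_eq]; rfl
  rw [SchwartzMap.fourierInv_coe, Real.fourierInv_eq', SchwartzMap.fourier_coe, hfg] at h1
  have h2 := integral_add_smul (E := Plane) (s := (2 * Real.pi)⁻¹) (by positivity) 0
    (fun v => Complex.exp (((2 * Real.pi * inner ℝ v z : ℝ) : ℂ) * Complex.I) • 𝓕 g v)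
  rw [h1] at h2
  rw [invFourierPlane]
  have h3 : ∀ ξ : Plane, extOp S (fun _ => 1) φ g ξ 0 *
      Complex.exp (Complex.I * ((ξ 0 * z 0 + ξ 1 * z 1 : ℝ) : ℂ)) =
      Complex.exp (((2 * Real.pi * inner ℝ (0 + (2 * Real.pi)⁻¹ • ξ) z : ℝ) : ℂ) * Complex.I) •
        𝓕 g (0 + (2 * Real.pi)⁻¹ • ξ) := fun ξ => by
    rw [extOp_one_eq_fourier hgS, phaseMul_zero, smul_eq_mul, mul_comm]
    congr 2
    rw [mul_comm]
    congr 2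
    simp only [zero_add, PiLp.inner_apply, Fin.sum_univ_two, PiLp.smul_apply, smul_eq_mul,
      RCLike.inner_apply, conj_trivial]
    field_simp
  simp_rw [h3]
  rw [h2, ← mul_assoc, ← Complex.ofReal_inv, ← Complex.ofReal_mul]
  simp only [finrank_euclideanSpace, Fintype.card_fin]
  rw [inv_pow, inv_inv, inv_mul_cancel₀ (by positivity), Complex.ofReal_one, one_mul]

/-- Plancherel's theorem for the extension operator at a fixed time. -/
theorem lintegral_extOp_sq (hS : IsOpen S) (hφ : ContDiffOn ℝ ∞ φ S) (hg : ContDiff ℝ ∞ g)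
    (hgc : HasCompactSupport g) (hgS : tsupport g ⊆ S) (τ : ℝ) :
    ∫⁻ ξ, ‖extOp S (fun _ => 1) φ g ξ τ‖ₑ ^ 2 =
      ENNReal.ofReal ((2 * Real.pi) ^ 2) * ∫⁻ z, ‖g z‖ₑ ^ 2 := by
  set f : 𝓢(Plane, ℂ) :=
    (hasCompactSupport_phaseMul hgc τ).toSchwartzMap (contDiff_phaseMul hS hφ hg hgS τ) with hf
  have hfg : ⇑f = phaseMul φ τ g := rfl
  simp_rw [extOp_one_eq_fourier hgS, ← hfg, ← SchwartzMap.fourier_coe]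
  have h := lintegral_add_smul (E := Plane) (s := (2 * Real.pi)⁻¹) (by positivity) 0
    (fun ζ => ‖(𝓕 f) ζ‖ₑ ^ 2)
  refine h.trans ?_
  rw [lintegral_enorm_sq ((𝓕 f).memLp 2), SchwartzMap.integral_norm_sq_fourier,
    ← lintegral_enorm_sq (F := f) (f.memLp 2 volume)]
  simp only [finrank_euclideanSpace, Fintype.card_fin]
  rw [inv_pow, inv_inv]
  congr 1
  refine lintegral_congr fun z => ?_
  rw [enorm_sq_eq_ofReal, enorm_sq_eq_ofReal, hfg, norm_phaseMul]

end Extension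

/-! ### Space-time Fourier support -/

section Distribution

open scoped FourierTransform

/-- A Schwartz function on `ℝ² × ℝ`, seen on the Euclidean space of three dimensions. -/
noncomputable def toEuclidean3 (T : 𝓢(Plane × ℝ, ℂ)) : 𝓢(WithLp 2 (Plane × ℝ), ℂ) :=
  SchwartzMap.compCLMOfContinuousLinearEquiv ℂ (WithLp.prodContinuousLinearEquiv 2 ℝ Plane ℝ) T

theorem toEuclidean3_apply (T : 𝓢(Plane × ℝ, ℂ)) (x : WithLp 2 (Plane × ℝ)) :
    toEuclidean3 T x = T x.ofLp := rfl

theorem finrank_euclidean3 : Module.finrank ℝ (WithLp 2 (Plane × ℝ)) = 3 := by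
  rw [(WithLp.linearEquiv 2 ℝ (Plane × ℝ)).finrank_eq, Module.finrank_prod]
  simp

theorem inner_toLp_prod (q r : Plane × ℝ) :
    inner ℝ (WithLp.toLp 2 q) (WithLp.toLp 2 r) = q.1 0 * r.1 0 + q.1 1 * r.1 1 + q.2 * r.2 := by
  rw [WithLp.prod_inner_apply]
  simp [PiLp.inner_apply, Fin.sum_univ_two]
  ring

theorem integral_toLp_prod (Φ : WithLp 2 (Plane × ℝ) → ℂ) :
    ∫ q : Plane × ℝ, Φ (WithLp.toLp 2 q) = ∫ x, Φ x :=
  (WithLp.volume_preserving_toLp Plane ℝ).integral_comp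
    (MeasurableEquiv.toLp 2 (Plane × ℝ)).measurableEmbedding Φ

/-- The product `ℝ² × ℝ` carries the maximum norm, so the Fourier transform is taken on the
Euclidean `WithLp 2` version and pulled back. -/
theorem invFourierSchwartz_eq (T : 𝓢(Plane × ℝ, ℂ)) (q : Plane × ℝ) :
    invFourierSchwartz T q.1 q.2 = (((2 * Real.pi) ^ 3 : ℝ) : ℂ)⁻¹ *
      𝓕⁻ (toEuclidean3 T) (0 + (2 * Real.pi)⁻¹ • WithLp.toLp 2 q) := by
  rw [invFourierSchwartz, SchwartzMap.fourierInv_coe, Real.fourierInv_eq', ← integral_toLp_prod]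
  congr 1
  refine integral_congr_ae (ae_of_all _ fun r => ?_)
  simp only [smul_eq_mul, toEuclidean3_apply, zero_add, inner_smul_right, inner_toLp_prod]
  rw [mul_comm]
  congr 2
  rw [mul_comm]
  congr 2
  field_simp

theorem integrable_invFourierSchwartz (T : 𝓢(Plane × ℝ, ℂ)) :
    Integrable (fun q : Plane × ℝ => invFourierSchwartz T q.1 q.2) := by
  simp_rw [invFourierSchwartz_eq]
  refine Integrable.const_mul ?_ _
  have h1 : MemLp (fun x => 𝓕⁻ (toEuclidean3 T) (0 + (2 * Real.pi)⁻¹ • x)) 1 :=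
    ((𝓕⁻ (toEuclidean3 T)).memLp 1).add_smul (by positivity) 0
  exact ((WithLp.volume_preserving_toLp Plane ℝ).integrable_comp_emb
    (MeasurableEquiv.toLp 2 (Plane × ℝ)).measurableEmbedding).2 (memLp_one_iff_integrable.1 h1)

theorem integral_invFourierSchwartz (T : 𝓢(Plane × ℝ, ℂ)) (z : Plane) (s : ℝ) :
    ∫ q : Plane × ℝ, Complex.exp (-(Complex.I * ((q.1 0 * z 0 + q.1 1 * z 1 + q.2 * s : ℝ) : ℂ))) *
      invFourierSchwartz T q.1 q.2 = T (z, s) := by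
  have h1 : 𝓕 (𝓕⁻ (toEuclidean3 T)) (WithLp.toLp 2 (z, s)) = T (z, s) := by
    rw [FourierTransform.fourier_fourierInv_eq]; rfl
  rw [SchwartzMap.fourier_coe, Real.fourier_eq'] at h1
  have h2 := integral_add_smul (E := WithLp 2 (Plane × ℝ)) (s := (2 * Real.pi)⁻¹)
    (by positivity) 0
    (fun v => Complex.exp (((-2 * Real.pi * inner ℝ v (WithLp.toLp 2 (z, s)) : ℝ) : ℂ) * Complex.I) •
      (𝓕⁻ (toEuclidean3 T)) v)
  rw [h1, ← integral_toLp_prod, finrank_euclidean3] at h2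
  simp_rw [invFourierSchwartz_eq]
  have h3 : ∀ q : Plane × ℝ,
      Complex.exp (-(Complex.I * ((q.1 0 * z 0 + q.1 1 * z 1 + q.2 * s : ℝ) : ℂ))) *
      ((((2 * Real.pi) ^ 3 : ℝ) : ℂ)⁻¹ *
        𝓕⁻ (toEuclidean3 T) (0 + (2 * Real.pi)⁻¹ • WithLp.toLp 2 q)) =
      (((2 * Real.pi) ^ 3 : ℝ) : ℂ)⁻¹ * (Complex.exp (((-2 * Real.pi *
        inner ℝ (0 + (2 * Real.pi)⁻¹ • WithLp.toLp 2 q) (WithLp.toLp 2 (z, s)) : ℝ) : ℂ) *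
          Complex.I) • (𝓕⁻ (toEuclidean3 T)) (0 + (2 * Real.pi)⁻¹ • WithLp.toLp 2 q)) := fun q => by
    rw [smul_eq_mul, mul_left_comm]
    congr 3
    simp only [zero_add, inner_smul_left, inner_toLp_prod, conj_trivial]
    have : -2 * Real.pi * ((2 * Real.pi)⁻¹ * (q.1 0 * z 0 + q.1 1 * z 1 + q.2 * s)) =
      -(q.1 0 * z 0 + q.1 1 * z 1 + q.2 * s) := by
      field_simp
    rw [this]
    push_cast
    ring
  simp_rw [h3]
  rw [integral_const_mul, h2, ← mul_assoc, ← Complex.ofReal_inv, ← Complex.ofReal_mul,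
    inv_pow, inv_inv, inv_mul_cancel₀ (by positivity), Complex.ofReal_one, one_mul]

variable {S : Set Plane} {φ : Plane → ℝ} {g : Plane → ℂ}

/-- By Fubini and Fourier inversion of the test function, the inverse transform is the measure with
density `g` carried by the graph of `φ`. -/
theorem invFourierDist_extOp (hS : IsOpen S) (hφ : ContinuousOn φ S) (hg : Continuous g)
    (hgc : HasCompactSupport g) (hgS : tsupport g ⊆ S) (T : 𝓢(Plane × ℝ, ℂ)) :
    invFourierDist (fun ξ τ => extOp S (fun _ => 1) φ g ξ τ) T = ∫ z, g z * T (z, φ z) := by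
  classical
  -- Nothing is known about `φ` off `S`, and Fubini needs a measurable integrand. Replacing `φ` by
  -- zero there changes nothing, since `g` vanishes off `S`.
  set ψ : Plane → ℝ := S.indicator φ with hψ
  have hψm : Measurable ψ := by
    have := (hφ.measurable_piecewise (g := fun _ => (0 : ℝ)) continuousOn_const hS.measurableSet)
    have e : ψ = S.piecewise φ fun _ => 0 := (Set.piecewise_eq_indicator (s := S) (f := φ)).symm
    rwa [e]
  have hgψ : ∀ (F : ℝ → ℂ) (z : Plane), g z * F (φ z) = g z * F (ψ z) := fun F z => by
    by_cases hz : z ∈ S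
    · rw [hψ, indicator_of_mem hz]
    · rw [image_eq_zero_of_notMem_tsupport (fun h => hz (hgS h)), zero_mul, zero_mul]
  have e1 : ∀ q : Plane × ℝ, extOp S (fun _ => 1) φ g q.1 q.2 * invFourierSchwartz T q.1 q.2 =
      ∫ z, g z * (Complex.exp (-(Complex.I *
        ((q.1 0 * z 0 + q.1 1 * z 1 + q.2 * ψ z : ℝ) : ℂ))) * invFourierSchwartz T q.1 q.2) :=
    fun q => by
    rw [extOp_one_eq_integral hgS, ← integral_mul_const]
    refine integral_congr_ae (ae_of_all _ fun z => ?_)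
    simp only
    rw [hgψ (fun s => Complex.exp (-(Complex.I *
        ((q.1 0 * z 0 + q.1 1 * z 1 + q.2 * s : ℝ) : ℂ)))) z, mul_assoc]
  have hgi : Integrable g := hg.integrable_of_hasCompactSupport hgc
  rw [invFourierDist]
  simp_rw [e1]
  rw [integral_integral_swap]
  · refine integral_congr_ae (ae_of_all _ fun z => ?_)
    simp only
    rw [integral_const_mul, integral_invFourierSchwartz, hgψ (fun s => T (z, s))]
  · have h0 : Integrable (fun p : (Plane × ℝ) × Plane =>
        invFourierSchwartz T p.1.1 p.1.2 * g p.2) :=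
      (integrable_invFourierSchwartz T).mul_prod hgi
    have h1 : AEStronglyMeasurable (fun p : (Plane × ℝ) × Plane => Complex.exp (-(Complex.I *
        ((p.1.1 0 * p.2 0 + p.1.1 1 * p.2 1 + p.1.2 * ψ p.2 : ℝ) : ℂ)))) := by
      refine Measurable.aestronglyMeasurable ?_
      have : Measurable fun p : (Plane × ℝ) × Plane => ψ p.2 := hψm.comp measurable_snd
      refine Complex.measurable_exp.comp ?_
      refine (measurable_const.mul (Complex.measurable_ofReal.comp ?_)).neg
      refine Measurable.add ?_ (Measurable.mul (by fun_prop) this)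
      exact Continuous.measurable (by fun_prop)
    refine (h0.bdd_mul (c := 1) h1 (ae_of_all _ fun p => (norm_exp_neg_I_mul _).le)).congr
      (ae_of_all _ fun p => ?_)
    simp only [Function.uncurry]
    ring

/-- The space-time Fourier transform of the extension of `g` lives on the graph of the phase. -/
theorem dsupport_extOp_subset (hS : IsOpen S) (hφ : ContinuousOn φ S) (hg : Continuous g)
    (hgc : HasCompactSupport g) (hgS : tsupport g ⊆ S) :
    Distribution.dsupport (invFourierDist (fun ξ τ => extOp S (fun _ => 1) φ g ξ τ)) ⊆
      (fun z => (z, φ z)) '' tsupport g := by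
  intro x hx
  rw [Distribution.mem_dsupport_iff] at hx
  refine hx _ ?_ ?_
  · intro T hT
    rw [invFourierDist_extOp hS hφ hg hgc hgS]
    refine integral_eq_zero_of_ae (ae_of_all _ fun z => ?_)
    by_cases hz : z ∈ tsupport g
    · have : (z, φ z) ∉ tsupport T := fun h => hT h ⟨z, hz, rfl⟩
      simp [image_eq_zero_of_notMem_tsupport this]
    · simp [image_eq_zero_of_notMem_tsupport hz]
  -- The part of the graph over the compact support is compact, hence closed.
  · exact (IsCompact.image_of_continuousOn hgc
      (continuousOn_id.prodMk (hφ.mono hgS))).isClosed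

end Distribution

/-! ### Windows and wave packet profiles -/

/-- A smooth bump on the line, equal to one on `[-1/2, 1/2]` and vanishing off `(-3/4, 3/4)`. -/
noncomputable def lineBump : ContDiffBump (0 : ℝ) := ⟨1 / 2, 3 / 4, by norm_num, by norm_num⟩

/-- The smooth window around `v` at scale `1 / R`. -/
noncomputable def window (R : ℝ) (v z : Plane) : ℝ :=
  lineBump (R * (z 0 - v 0)) * lineBump (R * (z 1 - v 1))

/-- The profile of a wave packet: a window around `v`, normalised in `L²` and modulated by `R k`. -/
noncomputable def profile (R : ℝ) (v : Plane) (k : Fin 2 → ℤ) (z : Plane) : ℂ :=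
  ((R * window R v z : ℝ) : ℂ) *
    Complex.exp (Complex.I * ((R * (k 0 * (z 0 - v 0) + k 1 * (z 1 - v 1)) : ℝ) : ℂ))

/-- The point `R⁻¹ l` of the lattice `R⁻¹ ℤ²`. -/
noncomputable def latticePoint (R : ℝ) (l : Fin 2 → ℤ) : Plane :=
  WithLp.toLp 2 fun i => R⁻¹ * l i

/-- The closed square with centre `v` and sides of length `3 / (2 R)`. -/
def closedBox (R : ℝ) (v : Plane) : Set Plane := {z | ∀ i, |R * (z i - v i)| ≤ 3 / 4}

section Window

variable {R : ℝ} {v z : Plane}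

theorem lineBump_eq_zero {x : ℝ} (hx : 3 / 4 ≤ |x|) : lineBump x = 0 :=
  lineBump.zero_of_le_dist (by simpa [lineBump, Real.dist_eq] using hx)

theorem lineBump_eq_one {x : ℝ} (hx : |x| ≤ 1 / 2) : lineBump x = 1 :=
  lineBump.one_of_mem_closedBall (by simpa [lineBump, Real.dist_eq] using hx)

theorem window_nonneg : 0 ≤ window R v z := mul_nonneg lineBump.nonneg lineBump.nonneg

theorem window_le_one : window R v z ≤ 1 :=
  mul_le_one₀ lineBump.le_one lineBump.nonneg lineBump.le_one

theorem window_eq_one (h : ∀ i, |R * (z i - v i)| ≤ 1 / 2) : window R v z = 1 := by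
  rw [window, lineBump_eq_one (h 0), lineBump_eq_one (h 1), one_mul]

theorem window_eq_zero (h : z ∉ closedBox R v) : window R v z = 0 := by
  simp only [closedBox, mem_ofPred_eq, Fin.forall_fin_two, not_and_or, not_le] at h
  rcases h with h | h
  · rw [window, lineBump_eq_zero h.le, zero_mul]
  · rw [window, lineBump_eq_zero h.le, mul_zero]

theorem contDiff_window : ContDiff ℝ ∞ (window R v) := by
  unfold window
  exact (lineBump.contDiff.comp (by fun_prop)).mul (lineBump.contDiff.comp (by fun_prop))

theorem contDiff_profile (k : Fin 2 → ℤ) : ContDiff ℝ ∞ (profile R v k) := by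
  unfold profile
  have h1 : ContDiff ℝ ∞ (fun z => ((R * window R v z : ℝ) : ℂ)) :=
    Complex.ofRealCLM.contDiff.comp (contDiff_const.mul contDiff_window)
  have h3 : ContDiff ℝ ∞ (fun z : Plane => R * (k 0 * (z 0 - v 0) + k 1 * (z 1 - v 1))) := by
    fun_prop
  have h2 : ContDiff ℝ ∞
      (fun z : Plane => ((R * (k 0 * (z 0 - v 0) + k 1 * (z 1 - v 1)) : ℝ) : ℂ)) :=
    Complex.ofRealCLM.contDiff.comp h3
  exact h1.mul (contDiff_const.mul h2).cexp

theorem isClosed_closedBox : IsClosed (closedBox R v) := by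
  simp only [closedBox, ofPred_forall]
  exact isClosed_iInter fun i => isClosed_le (by fun_prop) continuous_const

theorem closedBox_subset_openBox : closedBox R v ⊆ openBox R v :=
  fun _ hz i => (hz i).trans_lt (by norm_num)

theorem norm_sub_sq_le {c : ℝ} (hR : 0 < R) (hz : ∀ i, |R * (z i - v i)| ≤ c) :
    ‖z - v‖ ^ 2 ≤ 2 * (c / R) ^ 2 := by
  rw [EuclideanSpace.real_norm_sq_eq, Fin.sum_univ_two]
  have h : ∀ i, (z - v) i ^ 2 ≤ (c / R) ^ 2 := fun i => by
    have := hz i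
    rw [abs_mul, abs_of_pos hR, mul_comm, ← le_div_iff₀ hR] at this
    rw [← sq_abs]
    exact pow_le_pow_left₀ (abs_nonneg _) this 2
  linarith [h 0, h 1]

/-- The half-diagonal is `(3/4)√2 / R`, and `9/8 < 25/16`; the margin below `2/R` is what the
frequency localisation uses. -/
theorem norm_sub_lt_of_mem_closedBox (hR : 0 < R) (hz : z ∈ closedBox R v) :
    ‖z - v‖ < 5 / 4 / R := by
  have h := norm_sub_sq_le hR hz
  refine lt_of_pow_lt_pow_left₀ 2 (by positivity) (h.trans_lt ?_)
  rw [div_pow (3 / 4 : ℝ), div_pow (5 / 4 : ℝ), mul_div_assoc']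
  exact div_lt_div_of_pos_right (by norm_num) (by positivity)

theorem isCompact_closedBox (hR : 0 < R) : IsCompact (closedBox R v) := by
  refine isCompact_of_isClosed_isBounded isClosed_closedBox
    ((isBounded_ball (x := v) (r := 5 / 4 / R)).subset fun z hz => ?_)
  rw [mem_ball, dist_eq_norm]
  exact norm_sub_lt_of_mem_closedBox hR hz

theorem profile_eq_zero (k : Fin 2 → ℤ) (h : z ∉ closedBox R v) : profile R v k z = 0 := by
  simp [profile, window_eq_zero h]

theorem tsupport_profile_subset (k : Fin 2 → ℤ) : tsupport (profile R v k) ⊆ closedBox R v :=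
  closure_minimal (fun _ hz => by_contra fun h => hz (profile_eq_zero k h)) isClosed_closedBox

theorem hasCompactSupport_profile (hR : 0 < R) (k : Fin 2 → ℤ) :
    HasCompactSupport (profile R v k) :=
  (isCompact_closedBox hR).of_isClosed_subset (isClosed_tsupport _) (tsupport_profile_subset k)

end Window

/-! ### Bessel's inequality and almost orthogonality -/

section Bessel

variable {R : ℝ}

theorem mem_openBox_latticePoint (hR : 0 < R) {l : Fin 2 → ℤ} {z : Plane} :
    z ∈ openBox R (latticePoint R l) ↔ ∀ i, |R * z i - l i| < 1 := by
  simp only [openBox, latticePoint, mem_ofPred_eq, mul_sub, mul_inv_cancel_left₀ hR.ne']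

/-- At most four of the squares of side `2 / R` around the points of `R⁻¹ ℤ²` meet at a point. -/
theorem tsum_enorm_sq_le_four (hR : 0 < R) {m : (Fin 2 → ℤ) → ℂ} (hm : ∀ l, ‖m l‖ ≤ 1) (z : Plane)
    (hm0 : ∀ l, z ∉ openBox R (latticePoint R l) → m l = 0) : ∑' l, ‖m l‖ₑ ^ 2 ≤ 4 := by
  classical
  set s : Finset (Fin 2 → ℤ) :=
    Fintype.piFinset fun i => ({⌊R * z i⌋, ⌊R * z i⌋ + 1} : Finset ℤ) with hs
  have h0 : ∀ l ∉ s, ‖m l‖ₑ ^ 2 = 0 := fun l hl => by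
    rw [hm0 l, enorm_zero, zero_pow two_ne_zero]
    rw [mem_openBox_latticePoint hR]
    refine fun h => hl (Fintype.mem_piFinset.2 fun i => ?_)
    obtain ⟨h1, h2⟩ := abs_lt.1 (h i)
    have h3 : l i < ⌊R * z i⌋ + 2 := by
      have := Int.lt_floor_add_one (R * z i)
      have : (l i : ℝ) < ((⌊R * z i⌋ + 2 : ℤ) : ℝ) := by push_cast; linarith
      exact_mod_cast this
    have h4 : ⌊R * z i⌋ < l i + 1 := by
      rw [Int.floor_lt]
      push_cast
      linarith
    simp only [Finset.mem_insert, Finset.mem_singleton]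
    omega
  have hc : s.card ≤ 4 := by
    rw [hs, Fintype.card_piFinset, Fin.prod_univ_two]
    exact (Nat.mul_le_mul Finset.card_le_two Finset.card_le_two).trans (by norm_num)
  rw [tsum_eq_sum h0]
  refine (Finset.sum_le_card_nsmul s _ 1 fun l _ => ?_).trans ?_
  · rw [enorm_sq_eq_ofReal, ENNReal.ofReal_le_one]
    exact pow_le_one₀ (norm_nonneg _) (hm l)
  · rw [nsmul_one]
    exact_mod_cast hc

/-- Bessel's inequality for the windowed Fourier coefficients. -/
theorem tsum_boxCoeff_window_le (hR : 0 < R) {m : (Fin 2 → ℤ) → Plane → ℂ} {h : Plane → ℂ}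
    (hmeas : ∀ l, Measurable (m l)) (hm : ∀ l z, ‖m l z‖ ≤ 1)
    (hm0 : ∀ l, ∀ z ∉ openBox R (latticePoint R l), m l z = 0) (hh : MemLp h 2) :
    ∑' p : (Fin 2 → ℤ) × (Fin 2 → ℤ),
        ‖boxCoeff R (latticePoint R p.2) (fun z => m p.2 z * h z) p.1‖ₑ ^ 2 ≤
      ENNReal.ofReal ((2 * Real.pi / R) ^ 2) * (4 * ∫⁻ z, ‖h z‖ₑ ^ 2) := by
  have hmh : ∀ l, MemLp (fun z => m l z * h z) 2 := fun l =>
    hh.of_le ((hmeas l).aestronglyMeasurable.mul hh.1) (ae_of_all _ fun z => by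
      rw [norm_mul]
      exact mul_le_of_le_one_left (norm_nonneg _) (hm l z))
  -- The frequencies are summed first, square by square, by Parseval. The sum over squares then goes
  -- under the integral, where the overlap bound four applies.
  rw [ENNReal.tsum_prod', ENNReal.tsum_comm]
  simp_rw [fun l => tsum_boxCoeff hR (hmh l) (fun z hz => by rw [hm0 l z hz, zero_mul])]
  rw [ENNReal.tsum_mul_left, ← lintegral_tsum fun l => ((hmh l).1.enorm.pow_const 2),
    ← lintegral_const_mul' (4 : ℝ≥0∞) _ (by norm_num)]
  refine mul_le_mul_right (lintegral_mono fun z => ?_) _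
  simp_rw [enorm_mul, mul_pow]
  rw [ENNReal.tsum_mul_right]
  exact mul_le_mul_left (tsum_enorm_sq_le_four hR (fun l => hm l z) z fun l => hm0 l z) _

/-- Conjugation reverses the modulation, so testing against a profile is taking a windowed Fourier
coefficient; this puts the dual side of (P4) in reach of Bessel's inequality. -/
theorem integral_conj_profile_mul (v : Plane) (k : Fin 2 → ℤ) (h : Plane → ℂ) :
    ∫ z, (starRingEnd ℂ) (profile R v k z) * h z =
      R * boxCoeff R v (fun z => (window R v z : ℂ) * h z) k := by
  rw [boxCoeff, ← integral_const_mul]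
  refine integral_congr_ae (ae_of_all _ fun z => ?_)
  simp only [profile, map_mul, Complex.conj_ofReal, ← Complex.exp_conj, Complex.conj_I, neg_mul,
    Complex.ofReal_mul]
  ring

theorem memLp_profile (hR : 0 < R) (v : Plane) (k : Fin 2 → ℤ) (p : ℝ≥0∞) :
    MemLp (profile R v k) p :=
  (contDiff_profile k).continuous.memLp_of_hasCompactSupport (hasCompactSupport_profile hR k)

/-- The profiles form a Riesz sequence with an upper bound. -/
theorem lintegral_sum_profile_sq_le (hR : 0 < R)
    (W : Finset ((Fin 2 → ℤ) × (Fin 2 → ℤ))) :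
    ∫⁻ z, ‖∑ p ∈ W, profile R (latticePoint R p.2) p.1 z‖ₑ ^ 2 ≤
      ENNReal.ofReal ((4 * Real.pi) ^ 2 * W.card) := by
  set h : Plane → ℂ := fun z => ∑ p ∈ W, profile R (latticePoint R p.2) p.1 z with hh
  have hL : MemLp h 2 := memLp_finsetSum W fun p _ => memLp_profile hR _ _ 2
  set N : ℝ := ∫ z, ‖h z‖ ^ 2 with hN
  have hN0 : 0 ≤ N := integral_nonneg fun _ => by positivity
  set a : (Fin 2 → ℤ) × (Fin 2 → ℤ) → ℂ := fun p =>
    ∫ z, (starRingEnd ℂ) (profile R (latticePoint R p.2) p.1 z) * h z with ha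
  have hB := tsum_boxCoeff_window_le hR (m := fun l z => (window R (latticePoint R l) z : ℂ))
    (h := h) (fun l => (Complex.continuous_ofReal.comp contDiff_window.continuous).measurable)
    (fun l z => by
      rw [Complex.norm_real, Real.norm_of_nonneg window_nonneg]
      exact window_le_one)
    (fun l z hz => by
      rw [window_eq_zero (fun h => hz (closedBox_subset_openBox h)), Complex.ofReal_zero]) hL
  rw [lintegral_enorm_sq hL] at hB
  have hA : ∑ p ∈ W, ‖a p‖ ^ 2 ≤ (4 * Real.pi) ^ 2 * N := by
    have h1 : ∑ p ∈ W, ENNReal.ofReal (‖a p‖ ^ 2) ≤ ENNReal.ofReal ((4 * Real.pi) ^ 2 * N) := by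
      have h2 : ∀ p, ENNReal.ofReal (‖a p‖ ^ 2) = ENNReal.ofReal (R ^ 2) *
          ‖boxCoeff R (latticePoint R p.2)
            (fun z => (window R (latticePoint R p.2) z : ℂ) * h z) p.1‖ₑ ^ 2 := fun p => by
        simp only [ha]
        rw [integral_conj_profile_mul, enorm_sq_eq_ofReal, ← ENNReal.ofReal_mul (by positivity),
          norm_mul, mul_pow, Complex.norm_real, Real.norm_of_nonneg hR.le]
      simp_rw [h2]
      rw [← Finset.mul_sum]
      refine (mul_le_mul_right ((ENNReal.sum_le_tsum W).trans hB) _).trans (le_of_eq ?_)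
      rw [show (4 : ℝ≥0∞) = ENNReal.ofReal 4 by norm_num, ← ENNReal.ofReal_mul (by norm_num),
        ← ENNReal.ofReal_mul (by positivity), ← ENNReal.ofReal_mul (by positivity)]
      congr 1
      field_simp
      ring
    rw [← ENNReal.ofReal_sum_of_nonneg fun _ _ => by positivity] at h1
    exact (ENNReal.ofReal_le_ofReal_iff (by positivity)).1 h1
  -- Duality: the squared norm of the sum `h` is the sum of the inner products of `h` with its own
  -- terms.
  have hNa : (N : ℂ) = ∑ p ∈ W, a p := by
    simp only [ha, hN]
    rw [← integral_finsetSum _ fun p _ => ?_]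
    · rw [← integral_complex_ofReal]
      refine integral_congr_ae (ae_of_all _ fun z => ?_)
      simp only
      rw [← Finset.sum_mul, ← map_sum]
      change _ = (starRingEnd ℂ) (h z) * h z
      rw [Complex.conj_mul', Complex.ofReal_pow]
    · exact (memLp_profile hR _ _ 2).star.integrable_mul hL
  have hN1 : N ≤ ∑ p ∈ W, ‖a p‖ := by
    have := norm_sum_le W a
    rwa [← hNa, Complex.norm_real, Real.norm_of_nonneg hN0] at this
  -- Cauchy–Schwarz over `W` and Bessel bound `N²` by a multiple of `N`; one factor `N` is cancelled
  -- below, after the case `N = 0`.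
  have hN2 : N ^ 2 ≤ W.card * ((4 * Real.pi) ^ 2 * N) := by
    calc N ^ 2 ≤ (∑ p ∈ W, ‖a p‖) ^ 2 := pow_le_pow_left₀ hN0 hN1 2
      _ ≤ W.card * ∑ p ∈ W, ‖a p‖ ^ 2 := sq_sum_le_card_mul_sum_sq
      _ ≤ _ := by gcongr
  rw [lintegral_enorm_sq hL]
  refine ENNReal.ofReal_le_ofReal ?_
  rcases hN0.eq_or_lt with h0 | h0
  · rw [← hN, ← h0]; positivity
  · refine le_of_mul_le_mul_right ?_ h0
    rw [← hN]
    linarith [hN2]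

end Bessel

/-! ### Oscillatory integrals on the line -/

section Oscillatory

open scoped FourierTransform

theorem hasDerivAt_exp_neg_I_mul {p : ℝ → ℝ} {p' t : ℝ} (hp : HasDerivAt p p' t) :
    HasDerivAt (fun t => Complex.exp (-(Complex.I * (p t : ℂ))))
      (-(Complex.I * p') * Complex.exp (-(Complex.I * (p t : ℂ)))) t := by
  have := ((hp.ofReal_comp.const_mul Complex.I).neg).cexp
  rwa [mul_comm] at this

theorem one_add_abs_sq_le (a : ℝ) : (1 + |a|) ^ 2 ≤ 2 * (1 + a ^ 2) := by
  rw [← sq_abs a]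
  nlinarith [sq_nonneg (1 - |a|)]

/-- Integration by parts twice for an amplitude vanishing to first order at the endpoints. -/
theorem norm_integral_mul_exp_le {k k' k'' : ℝ → ℂ} {b M : ℝ} (hb : 0 ≤ b)
    (h1 : ∀ t ∈ Icc (-b) b, HasDerivAt k (k' t) t)
    (h2 : ∀ t ∈ Icc (-b) b, HasDerivAt k' (k'' t) t) (hc : ContinuousOn k'' (Icc (-b) b))
    (hk : k (-b) = 0 ∧ k b = 0) (hk' : k' (-b) = 0 ∧ k' b = 0)
    (hM : ∀ t ∈ Icc (-b) b, ‖k t‖ ≤ M) (hM'' : ∀ t ∈ Icc (-b) b, ‖k'' t‖ ≤ M) (a : ℝ) :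
    ‖∫ t in -b..b, k t * Complex.exp (-(Complex.I * ((a * t : ℝ) : ℂ)))‖ ≤
      8 * b * M * ((1 + |a|) ^ 2)⁻¹ := by
  have hle : -b ≤ b := by linarith
  set e : ℝ → ℂ := fun t => Complex.exp (-(Complex.I * ((a * t : ℝ) : ℂ))) with he
  have hed : ∀ t, HasDerivAt e (-(Complex.I * a) * e t) t := fun t => by
    have : HasDerivAt (fun t : ℝ => a * t) a t := by simpa using (hasDerivAt_id t).const_mul a
    exact hasDerivAt_exp_neg_I_mul this
  have hec : Continuous e := continuous_iff_continuousAt.2 fun t => (hed t).continuousAt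
  have hkc : ContinuousOn k (uIcc (-b) b) := by
    rw [uIcc_of_le hle]
    exact fun t ht => (h1 t ht).continuousAt.continuousWithinAt
  have hkc' : ContinuousOn k' (uIcc (-b) b) := by
    rw [uIcc_of_le hle]
    exact fun t ht => (h2 t ht).continuousAt.continuousWithinAt
  have hkc'' : ContinuousOn k'' (uIcc (-b) b) := by rwa [uIcc_of_le hle]
  have hei : IntervalIntegrable (fun t => -(Complex.I * a) * e t) volume (-b) b :=
    (continuous_const.mul hec).intervalIntegrable _ _
  have i1 := intervalIntegral.integral_mul_deriv_eq_deriv_mul (u := e) (v := k)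
    (u' := fun t => -(Complex.I * a) * e t) (v' := k') (a := -b) (b := b)
    (fun t _ => hed t) (fun t ht => h1 t (by rwa [uIcc_of_le hle] at ht)) hei
    hkc'.intervalIntegrable
  have i2 := intervalIntegral.integral_mul_deriv_eq_deriv_mul (u := e) (v := k')
    (u' := fun t => -(Complex.I * a) * e t) (v' := k'') (a := -b) (b := b)
    (fun t _ => hed t) (fun t ht => h2 t (by rwa [uIcc_of_le hle] at ht)) hei
    hkc''.intervalIntegrable
  rw [hk.1, hk.2] at i1
  rw [hk'.1, hk'.2] at i2
  simp only [mul_zero, sub_zero, zero_sub, mul_assoc, intervalIntegral.integral_const_mul] at i1 i2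
  set J : ℂ := ∫ t in -b..b, k t * e t with hJ
  have hJ' : ∫ t in -b..b, e t * k t = J := by simp_rw [hJ, mul_comm]
  have i3 : ∫ t in -b..b, e t * k'' t = -((a : ℂ) ^ 2 * J) := by
    simp only [neg_mul, neg_neg] at i1 i2
    rw [i2, i1, hJ']
    linear_combination (a : ℂ) ^ 2 * J * Complex.I_sq
  have hen : ∀ t, ‖e t‖ = 1 := fun t => norm_exp_neg_I_mul _
  have hsub : uIoc (-b) b ⊆ Icc (-b) b := by
    rw [uIoc_of_le hle]
    exact Ioc_subset_Icc_self
  have b1 : ‖J‖ ≤ M * (2 * b) := by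
    have := intervalIntegral.norm_integral_le_of_norm_le_const (a := -b) (b := b) (C := M)
      (f := fun t => k t * e t) fun t ht => by
        rw [norm_mul, hen, mul_one]
        exact hM t (hsub ht)
    rwa [show b - -b = 2 * b by ring, abs_of_nonneg (by positivity)] at this
  have b2 : a ^ 2 * ‖J‖ ≤ M * (2 * b) := by
    have := intervalIntegral.norm_integral_le_of_norm_le_const (a := -b) (b := b) (C := M)
      (f := fun t => e t * k'' t) fun t ht => by
        rw [norm_mul, hen, one_mul]
        exact hM'' t (hsub ht)
    rw [show b - -b = 2 * b by ring, abs_of_nonneg (by positivity), i3, norm_neg, norm_mul,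
      norm_pow, Complex.norm_real, Real.norm_eq_abs, sq_abs] at this
    exact this
  -- Both `‖J‖` and `a²‖J‖` are at most `2bM`, and `(1 + |a|)² ≤ 2(1 + a²)`; hence the constant
  -- `8bM`.
  rw [← div_eq_mul_inv, le_div_iff₀ (by positivity)]
  nlinarith [one_add_abs_sq_le a, norm_nonneg J]

theorem exists_schwartz_bound (f : 𝓢(ℝ, ℂ)) :
    ∃ D : ℝ, 0 ≤ D ∧ ∀ x, ‖f x‖ ≤ D * ((1 + |x|) ^ 2)⁻¹ := by
  refine ⟨2 ^ 2 * (Finset.Iic (2, 0)).sup (fun m => SchwartzMap.seminorm ℝ m.1 m.2) f,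
    by positivity, fun x => ?_⟩
  have := SchwartzMap.one_add_le_sup_seminorm_apply (𝕜 := ℝ) (m := (2, 0)) (k := 2) (n := 0)
    le_rfl le_rfl f x
  rw [← div_eq_mul_inv, le_div_iff₀ (by positivity), mul_comm]
  simpa using this

/-- The bump on the line as a complex-valued Schwartz function. -/
noncomputable def lineBumpSchwartz : 𝓢(ℝ, ℂ) :=
  HasCompactSupport.toSchwartzMap (f := fun x => (lineBump x : ℂ))
    (lineBump.hasCompactSupport.comp_left Complex.ofReal_zero)
    (Complex.ofRealCLM.contDiff.comp lineBump.contDiff)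

theorem lineBumpSchwartz_apply (x : ℝ) : lineBumpSchwartz x = lineBump x := rfl

/-- The Fourier transform of the bump, in the normalisation `∫ χ(x) exp(-isx) dx`. -/
noncomputable def lineBumpFourier : 𝓢(ℝ, ℂ) :=
  SchwartzMap.compCLMOfContinuousLinearEquiv ℂ
    (ContinuousLinearEquiv.smulLeft (Units.mk0 (2 * Real.pi)⁻¹ (by positivity)))
    (𝓕 lineBumpSchwartz)

theorem lineBumpFourier_apply (s : ℝ) : lineBumpFourier s =
    ∫ x, (lineBump x : ℂ) * Complex.exp (-(Complex.I * ((s * x : ℝ) : ℂ))) := by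
  change 𝓕 lineBumpSchwartz ((2 * Real.pi)⁻¹ * s) = _
  rw [SchwartzMap.fourier_coe, Real.fourier_eq']
  refine integral_congr_ae (ae_of_all _ fun x => ?_)
  simp only [smul_eq_mul, lineBumpSchwartz_apply, RCLike.inner_apply, conj_trivial]
  rw [mul_comm]
  congr 2
  have : -2 * Real.pi * ((2 * Real.pi)⁻¹ * s * x) = -(s * x) := by field_simp
  rw [this]
  push_cast
  ring

/-- A bounded shift costs only a constant, because `1 + |a| ≤ (1 + K)(1 + |a + q|)`. It serves to
replace the argument `a₁ + Q t` by `a₁`. -/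
theorem one_add_abs_inv_sq_le {a q K : ℝ} (hq : |q| ≤ K) :
    ((1 + |a + q|) ^ 2)⁻¹ ≤ (1 + K) ^ 2 * ((1 + |a|) ^ 2)⁻¹ := by
  have hK : 0 ≤ K := (abs_nonneg q).trans hq
  have h1 : 1 + |a| ≤ (1 + K) * (1 + |a + q|) := by
    have : |a| ≤ |a + q| + |q| := by
      have := abs_sub (a + q) q
      rwa [add_sub_cancel_right] at this
    nlinarith [abs_nonneg (a + q)]
  rw [← div_eq_mul_inv, le_div_iff₀ (by positivity), inv_mul_le_iff₀ (by positivity), ← mul_pow,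
    mul_comm]
  exact pow_le_pow_left₀ (by positivity) h1 2

/-- Decay of the oscillatory integral to which the extension of a profile reduces when the phase is
affine in the first variable. -/
theorem exists_oscillatory_bound {K : ℝ} (hK : 0 ≤ K) :
    ∃ C : ℝ, 0 ≤ C ∧ ∀ (P P' P'' Q Q' Q'' : ℝ → ℝ),
      (∀ t ∈ Icc (-(3 / 4) : ℝ) (3 / 4), HasDerivAt P (P' t) t ∧ HasDerivAt P' (P'' t) t ∧
        HasDerivAt Q (Q' t) t ∧ HasDerivAt Q' (Q'' t) t) →
      ContinuousOn P'' (Icc (-(3 / 4) : ℝ) (3 / 4)) →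
      ContinuousOn Q'' (Icc (-(3 / 4) : ℝ) (3 / 4)) →
      (∀ t ∈ Icc (-(3 / 4) : ℝ) (3 / 4), |P' t| ≤ K ∧ |P'' t| ≤ K ∧ |Q t| ≤ K ∧ |Q' t| ≤ K ∧
        |Q'' t| ≤ K) →
      ∀ a₁ a₂ : ℝ, ‖∫ t in -(3 / 4 : ℝ)..(3 / 4), ((lineBump t : ℂ) * (lineBumpFourier (a₁ + Q t) *
        Complex.exp (-(Complex.I * (P t : ℂ))))) * Complex.exp (-(Complex.I * ((a₂ * t : ℝ) : ℂ)))‖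
        ≤ C * ((1 + |a₁|) ^ 2)⁻¹ * ((1 + |a₂|) ^ 2)⁻¹ := by
  set Y := lineBumpFourier
  set Y₁ := SchwartzMap.derivCLM ℝ ℂ Y with hY₁
  set Y₂ := SchwartzMap.derivCLM ℝ ℂ Y₁ with hY₂
  set u := lineBumpSchwartz
  set u₁ := SchwartzMap.derivCLM ℝ ℂ u with hu₁
  set u₂ := SchwartzMap.derivCLM ℝ ℂ u₁ with hu₂
  have hder : ∀ (f : 𝓢(ℝ, ℂ)) (x : ℝ), HasDerivAt f (SchwartzMap.derivCLM ℝ ℂ f x) x := fun f x => by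
    rw [SchwartzMap.derivCLM_apply]
    exact f.differentiableAt.hasDerivAt
  obtain ⟨D₀, hD₀, hY0⟩ := exists_schwartz_bound Y
  obtain ⟨D₁, hD₁, hY1⟩ := exists_schwartz_bound Y₁
  obtain ⟨D₂, hD₂, hY2⟩ := exists_schwartz_bound Y₂
  obtain ⟨B₀, hB₀, hu0⟩ := exists_schwartz_bound u
  obtain ⟨B₁, hB₁, hu1⟩ := exists_schwartz_bound u₁
  obtain ⟨B₂, hB₂, hu2⟩ := exists_schwartz_bound u₂
  set D := D₀ + D₁ + D₂ with hD
  set B := B₀ + B₁ + B₂ with hB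
  have hDn : 0 ≤ D := by positivity
  have hBn : 0 ≤ B := by positivity
  have hle1 : ∀ x : ℝ, ((1 + |x|) ^ 2)⁻¹ ≤ 1 := fun x =>
    inv_le_one_of_one_le₀ (one_le_pow₀ (by linarith [abs_nonneg x]))
  have hu0' : ∀ x, ‖u x‖ ≤ B := fun x => by nlinarith [hu0 x, hle1 x]
  have hu1' : ∀ x, ‖u₁ x‖ ≤ B := fun x => by nlinarith [hu1 x, hle1 x]
  have hu2' : ∀ x, ‖u₂ x‖ ≤ B := fun x => by nlinarith [hu2 x, hle1 x]
  -- Here `w`, `w'`, `w''` are at most `y`, `2Ky` and `(2K + 4K²)y`. The second derivative `u''w +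
  -- 2u'w' + uw''` is thus bounded by `B(1 + 6K + 4K²)y`, and `8 · 3/4` is the factor `8b` of the
  -- integration by parts.
  refine ⟨8 * (3 / 4) * (B * (1 + 6 * K + 4 * K ^ 2) * (D * (1 + K) ^ 2)), by positivity,
    fun P P' P'' Q Q' Q'' hd hP'' hQ'' hbd a₁ a₂ => ?_⟩
  set y : ℝ := D * (1 + K) ^ 2 * ((1 + |a₁|) ^ 2)⁻¹ with hy
  have hyn : 0 ≤ y := by positivity
  have hYb : ∀ {f : ℝ → ℂ} {d : ℝ}, d ≤ D → (∀ x, ‖f x‖ ≤ d * ((1 + |x|) ^ 2)⁻¹) →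
      ∀ t ∈ Icc (-(3 / 4) : ℝ) (3 / 4), ‖f (a₁ + Q t)‖ ≤ y := fun hdD hf t ht => by
    refine (hf _).trans ?_
    rw [hy, mul_assoc]
    exact mul_le_mul hdD (one_add_abs_inv_sq_le (hbd t ht).2.2.1) (by positivity) hDn
  have y0 := hYb (by linarith) hY0
  have y1 := hYb (by linarith) hY1
  have y2 := hYb (by linarith) hY2
  set e : ℝ → ℂ := fun t => Complex.exp (-(Complex.I * (P t : ℂ))) with he
  have hen : ∀ t, ‖e t‖ = 1 := fun t => norm_exp_neg_I_mul _
  set w : ℝ → ℂ := fun t => Y (a₁ + Q t) * e t with hw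
  set w₁ : ℝ → ℂ := fun t => (Q' t * Y₁ (a₁ + Q t) - Complex.I * P' t * Y (a₁ + Q t)) * e t with hw₁
  set w₂ : ℝ → ℂ := fun t =>
    ((Q'' t * Y₁ (a₁ + Q t) + Q' t * (Q' t * Y₂ (a₁ + Q t))) -
      (Complex.I * P'' t * Y (a₁ + Q t) + Complex.I * P' t * (Q' t * Y₁ (a₁ + Q t))) -
      Complex.I * P' t * (Q' t * Y₁ (a₁ + Q t) - Complex.I * P' t * Y (a₁ + Q t))) * e t with hw₂
  have hcomp : ∀ (f : 𝓢(ℝ, ℂ)), ∀ t ∈ Icc (-(3 / 4) : ℝ) (3 / 4),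
      HasDerivAt (fun t => f (a₁ + Q t)) (Q' t * SchwartzMap.derivCLM ℝ ℂ f (a₁ + Q t)) t :=
    fun f t ht => by
    have := HasDerivAt.scomp t (hder f (a₁ + Q t)) ((hd t ht).2.2.1.const_add a₁)
    simpa [Function.comp_def] using this
  have hwd : ∀ t ∈ Icc (-(3 / 4) : ℝ) (3 / 4), HasDerivAt w (w₁ t) t := fun t ht => by
    have := (hcomp Y t ht).mul (hasDerivAt_exp_neg_I_mul (hd t ht).1)
    convert! this using 1
    simp only [hw₁, he, hY₁]
    ring
  have hwd₁ : ∀ t ∈ Icc (-(3 / 4) : ℝ) (3 / 4), HasDerivAt w₁ (w₂ t) t := fun t ht => by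
    have h1 := ((hd t ht).2.2.2.ofReal_comp.mul (hcomp Y₁ t ht)).sub
      (((hd t ht).2.1.ofReal_comp.const_mul Complex.I).mul (hcomp Y t ht))
    have := h1.mul (hasDerivAt_exp_neg_I_mul (hd t ht).1)
    convert! this using 1
    simp only [hw₂, he, hY₁, hY₂, Pi.sub_apply, Pi.mul_apply]
    ring
  have n0 : ∀ t ∈ Icc (-(3 / 4) : ℝ) (3 / 4), ‖w t‖ ≤ y := fun t ht => by
    rw [hw, norm_mul, hen, mul_one]
    exact y0 t ht
  have nmul : ∀ {r d : ℝ} {c : ℂ}, |r| ≤ K → ‖c‖ ≤ d → ‖(r : ℂ) * c‖ ≤ K * d := fun hr hc => by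
    rw [norm_mul, Complex.norm_real, Real.norm_eq_abs]
    exact mul_le_mul hr hc (norm_nonneg _) hK
  have nmulI : ∀ {r d : ℝ} {c : ℂ}, |r| ≤ K → ‖c‖ ≤ d → ‖Complex.I * (r : ℂ) * c‖ ≤ K * d :=
    fun hr hc => by
      rw [mul_assoc, norm_mul, Complex.norm_I, one_mul]
      exact nmul hr hc
  have n1' : ∀ t ∈ Icc (-(3 / 4) : ℝ) (3 / 4),
      ‖Q' t * Y₁ (a₁ + Q t) - Complex.I * P' t * Y (a₁ + Q t)‖ ≤ K * y + K * y := fun t ht => by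
    obtain ⟨b1, b2, b3, b4, b5⟩ := hbd t ht
    exact (norm_sub_le _ _).trans (add_le_add (nmul b4 (y1 t ht)) (nmulI b1 (y0 t ht)))
  have n1 : ∀ t ∈ Icc (-(3 / 4) : ℝ) (3 / 4), ‖w₁ t‖ ≤ K * y + K * y := fun t ht => by
    rw [hw₁, norm_mul, hen, mul_one]
    exact n1' t ht
  have n2 : ∀ t ∈ Icc (-(3 / 4) : ℝ) (3 / 4),
      ‖w₂ t‖ ≤ (K * y + K * (K * y)) + (K * y + K * (K * y)) + K * (K * y + K * y) := fun t ht => by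
    obtain ⟨b1, b2, b3, b4, b5⟩ := hbd t ht
    rw [hw₂, norm_mul, hen, mul_one]
    refine (norm_sub_le _ _).trans (add_le_add ((norm_sub_le _ _).trans (add_le_add
      ((norm_add_le _ _).trans (add_le_add (nmul b5 (y1 t ht)) (nmul b4 (nmul b4 (y2 t ht)))))
      ((norm_add_le _ _).trans (add_le_add (nmulI b2 (y0 t ht)) (nmulI b1 (nmul b4 (y1 t ht)))))))
      (nmulI b1 (n1' t ht)))
  have nBmul : ∀ {d : ℝ} {c c' : ℂ}, ‖c'‖ ≤ B → ‖c‖ ≤ d → ‖c' * c‖ ≤ B * d := fun h h' => by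
    rw [norm_mul]
    exact mul_le_mul h h' (norm_nonneg _) hBn
  have hwc : ContinuousOn w (Icc (-(3 / 4)) (3 / 4)) := fun t ht =>
    (hwd t ht).continuousAt.continuousWithinAt
  have hwc₁ : ContinuousOn w₁ (Icc (-(3 / 4)) (3 / 4)) := fun t ht =>
    (hwd₁ t ht).continuousAt.continuousWithinAt
  have hwc₂ : ContinuousOn w₂ (Icc (-(3 / 4)) (3 / 4)) := by
    have cP : ContinuousOn (fun t => (P t : ℂ)) (Icc (-(3 / 4)) (3 / 4)) := fun t ht =>
      (hd t ht).1.ofReal_comp.continuousAt.continuousWithinAt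
    have cP' : ContinuousOn (fun t => (P' t : ℂ)) (Icc (-(3 / 4)) (3 / 4)) := fun t ht =>
      (hd t ht).2.1.ofReal_comp.continuousAt.continuousWithinAt
    have cQ : ContinuousOn (fun t => a₁ + Q t) (Icc (-(3 / 4)) (3 / 4)) := fun t ht =>
      ((hd t ht).2.2.1.const_add a₁).continuousAt.continuousWithinAt
    have cQ' : ContinuousOn (fun t => (Q' t : ℂ)) (Icc (-(3 / 4)) (3 / 4)) := fun t ht =>
      (hd t ht).2.2.2.ofReal_comp.continuousAt.continuousWithinAt
    have cP'' := Complex.continuous_ofReal.comp_continuousOn hP''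
    have cQ'' := Complex.continuous_ofReal.comp_continuousOn hQ''
    have cY : ∀ f : 𝓢(ℝ, ℂ), ContinuousOn (fun t => f (a₁ + Q t)) (Icc (-(3 / 4)) (3 / 4)) :=
      fun f => f.continuous.comp_continuousOn cQ
    have cI : ContinuousOn (fun _ : ℝ => Complex.I) (Icc (-(3 / 4)) (3 / 4)) := continuousOn_const
    exact ((((cQ''.mul (cY Y₁)).add (cQ'.mul (cQ'.mul (cY Y₂)))).sub
      (((cI.mul cP'').mul (cY Y)).add ((cI.mul cP').mul (cQ'.mul (cY Y₁))))).sub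
      ((cI.mul cP').mul ((cQ'.mul (cY Y₁)).sub ((cI.mul cP').mul (cY Y))))).mul
      (cI.mul cP).neg.cexp
  have hu_end : ∀ t : ℝ, |t| = 3 / 4 → u t = 0 ∧ u₁ t = 0 := fun t ht => by
    have h0 : u t = 0 := by
      rw [lineBumpSchwartz_apply, lineBump_eq_zero ht.ge, Complex.ofReal_zero]
    refine ⟨h0, ?_⟩
    -- The bump is nonnegative and vanishes at the endpoints, so they are minima and its derivative
    -- vanishes there too: no boundary terms arise.
    have hmin : IsLocalMin (fun x => lineBump x) t := Filter.Eventually.of_forall fun x => by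
      exact (lineBump_eq_zero ht.ge).le.trans lineBump.nonneg
    have hd1 : HasDerivAt (fun x => (lineBump x : ℂ)) ((0 : ℝ) : ℂ) t := by
      have := ((lineBump.contDiff (n := 1)).differentiable (by norm_num) t).hasDerivAt
      rw [hmin.deriv_eq_zero] at this
      exact this.ofReal_comp
    exact ((hder u t).unique hd1).trans Complex.ofReal_zero
  have hend1 := hu_end (-(3 / 4)) (by norm_num)
  have hend2 := hu_end (3 / 4) (by norm_num)
  have key := norm_integral_mul_exp_le (k := fun t => u t * w t)
    (k' := fun t => u₁ t * w t + u t * w₁ t)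
    (k'' := fun t => (u₂ t * w t + u₁ t * w₁ t) + (u₁ t * w₁ t + u t * w₂ t)) (b := 3 / 4)
    (M := B * (1 + 6 * K + 4 * K ^ 2) * y) (by norm_num)
    (fun t ht => (hder u t).mul (hwd t ht))
    (fun t ht => ((hder u₁ t).mul (hwd t ht)).add ((hder u t).mul (hwd₁ t ht)))
    (((u₂.continuous.continuousOn.mul hwc).add (u₁.continuous.continuousOn.mul hwc₁)).add
      ((u₁.continuous.continuousOn.mul hwc₁).add (u.continuous.continuousOn.mul hwc₂)))
    (by simp [hend1, hend2]) (by simp [hend1, hend2])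
    (fun t ht => (nBmul (hu0' t) (n0 t ht)).trans (by
      rw [mul_assoc]
      exact mul_le_mul_of_nonneg_left (by nlinarith [mul_nonneg hK hyn, mul_nonneg (sq_nonneg K) hyn])
        hBn))
    (fun t ht => ((norm_add_le _ _).trans (add_le_add
      ((norm_add_le _ _).trans (add_le_add (nBmul (hu2' t) (n0 t ht)) (nBmul (hu1' t) (n1 t ht))))
      ((norm_add_le _ _).trans (add_le_add (nBmul (hu1' t) (n1 t ht))
        (nBmul (hu0' t) (n2 t ht)))))).trans (le_of_eq (by ring))) a₂
  refine le_trans (le_of_eq ?_) (key.trans (le_of_eq (by rw [hy]; ring)))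
  rfl

end Oscillatory

/-! ### Coordinates on a square and affine phases -/

section PartialDeriv

variable {S : Set Plane} {h : Plane → ℝ} {z : Plane}

theorem ContDiffOn.partialDeriv (hS : IsOpen S) (hh : ContDiffOn ℝ ∞ h S) (i : Fin 2) :
    ContDiffOn ℝ ∞ (partialDeriv i h) S :=
  (hh.fderiv_of_isOpen hS (by simp)).clm_apply contDiffOn_const

theorem differentiableAt_of_contDiffOn (hS : IsOpen S) (hh : ContDiffOn ℝ ∞ h S) (hz : z ∈ S) :
    DifferentiableAt ℝ h z :=
  (hh.contDiffAt (hS.mem_nhds hz)).differentiableAt (by simp)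

/-- `mixedPartial` takes the derivatives in the second variable first, whereas differentiating `∂₁φ`
along `t` produces the other order. -/
theorem partialDeriv_comm (hS : IsOpen S) (hh : ContDiffOn ℝ ∞ h S) (hz : z ∈ S) (i j : Fin 2) :
    partialDeriv i (partialDeriv j h) z = partialDeriv j (partialDeriv i h) z := by
  have hd : DifferentiableAt ℝ (fderiv ℝ h) z :=
    ((hh.fderiv_of_isOpen (m := ∞) hS (by simp)).contDiffAt (hS.mem_nhds hz)).differentiableAt
      (by simp)
  have e : ∀ i j : Fin 2, partialDeriv i (partialDeriv j h) z =
      fderiv ℝ (fderiv ℝ h) z (EuclideanSpace.single i 1) (EuclideanSpace.single j 1) := by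
    intro i j
    change fderiv ℝ (fun z => fderiv ℝ h z (EuclideanSpace.single j 1)) z _ = _
    rw [fderiv_clm_apply hd (differentiableAt_const _)]
    simp
  rw [e, e]
  exact ((hh.contDiffAt (hS.mem_nhds hz)).isSymmSndFDerivAt (by
    simp only [minSmoothness_of_isRCLikeNormedField]
    exact WithTop.coe_le_coe.2 (le_top : (2 : ℕ∞) ≤ ⊤))) _ _

end PartialDeriv

section BoxPoint

variable {R : ℝ} {v : Plane} {x t : ℝ}

/-- The point with rescaled coordinates `(x, t)` relative to the centre `v`. -/
noncomputable def boxPoint (R : ℝ) (v : Plane) (x t : ℝ) : Plane :=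
  v + R⁻¹ • (x • EuclideanSpace.single 0 1 + t • EuclideanSpace.single 1 1)

theorem boxPoint_apply_zero : boxPoint R v x t 0 = v 0 + R⁻¹ * x := by simp [boxPoint]

theorem boxPoint_apply_one : boxPoint R v x t 1 = v 1 + R⁻¹ * t := by simp [boxPoint]

theorem boxPoint_zero : boxPoint R v 0 0 = v := by simp [boxPoint]

theorem boxPoint_mem_closedBox (hR : 0 < R) (hx : x ∈ Icc (-(3 / 4) : ℝ) (3 / 4))
    (ht : t ∈ Icc (-(3 / 4) : ℝ) (3 / 4)) : boxPoint R v x t ∈ closedBox R v := by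
  rw [closedBox, mem_ofPred_eq, Fin.forall_fin_two, boxPoint_apply_zero, boxPoint_apply_one,
    add_sub_cancel_left, add_sub_cancel_left, mul_inv_cancel_left₀ hR.ne',
    mul_inv_cancel_left₀ hR.ne', abs_le, abs_le]
  exact ⟨hx, ht⟩

theorem hasDerivAt_boxPoint_left {h : Plane → ℝ}
    (hh : DifferentiableAt ℝ h (boxPoint R v x t)) :
    HasDerivAt (fun x => h (boxPoint R v x t)) (R⁻¹ * partialDeriv 0 h (boxPoint R v x t)) x := by
  have h1 : HasDerivAt (fun x => boxPoint R v x t)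
      (R⁻¹ • ((1 : ℝ) • EuclideanSpace.single (0 : Fin 2) (1 : ℝ))) x :=
    ((((hasDerivAt_id x).smul_const _).add_const _).const_smul R⁻¹).const_add v
  have := hh.hasFDerivAt.comp_hasDerivAt x h1
  simpa [_root_.partialDeriv, Function.comp_def] using this

theorem hasDerivAt_boxPoint_right {h : Plane → ℝ}
    (hh : DifferentiableAt ℝ h (boxPoint R v x t)) :
    HasDerivAt (fun t => h (boxPoint R v x t)) (R⁻¹ * partialDeriv 1 h (boxPoint R v x t)) t := by
  have h1 : HasDerivAt (fun t => boxPoint R v x t)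
      (R⁻¹ • ((1 : ℝ) • EuclideanSpace.single (1 : Fin 2) (1 : ℝ))) t :=
    ((((hasDerivAt_id t).smul_const _).const_add _).const_smul R⁻¹).const_add v
  have := hh.hasFDerivAt.comp_hasDerivAt t h1
  simpa [_root_.partialDeriv, Function.comp_def] using this

theorem continuous_boxPoint_right : Continuous fun t => boxPoint R v x t := by
  unfold boxPoint
  fun_prop

end BoxPoint

section Fubini

/-- The first variable is innermost: the phase is affine in it, so that integral is evaluated
exactly. -/
theorem integral_plane_eq {Ψ : Plane → ℂ} (hΨ : Integrable Ψ) :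
    ∫ u, Ψ u = ∫ t : ℝ, ∫ x : ℝ,
      Ψ (x • EuclideanSpace.single 0 1 + t • EuclideanSpace.single 1 1) := by
  have hmp : MeasurePreserving
      ((MeasurableEquiv.finTwoArrow (α := ℝ)).symm.trans (MeasurableEquiv.toLp 2 (Fin 2 → ℝ)))
      volume volume :=
    (PiLp.volume_preserving_toLp (Fin 2)).comp (volume_preserving_finTwoArrow ℝ).symm
  have hemb := ((MeasurableEquiv.finTwoArrow (α := ℝ)).symm.trans
    (MeasurableEquiv.toLp 2 (Fin 2 → ℝ))).measurableEmbedding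
  have e : ∀ q : ℝ × ℝ, ((MeasurableEquiv.finTwoArrow (α := ℝ)).symm.trans
      (MeasurableEquiv.toLp 2 (Fin 2 → ℝ))) q =
      q.1 • EuclideanSpace.single 0 1 + q.2 • EuclideanSpace.single 1 1 := fun q => by
    ext i
    fin_cases i <;> simp [MeasurableEquiv.finTwoArrow]
  rw [← hmp.integral_comp hemb Ψ]
  have hi := (hmp.integrable_comp_emb hemb).2 hΨ
  rw [Measure.volume_eq_prod] at hi ⊢
  refine (integral_prod_symm _ hi).trans ?_
  simp only [Function.comp_apply, e]

end Fubini

section AffinePhase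

variable {R : ℝ} {v : Plane} {S : Set Plane} {φ : Plane → ℝ}

theorem eq_of_forall_hasDerivAt_zero {f : ℝ → ℝ} {b x y : ℝ}
    (hf : ∀ s ∈ Icc (-b) b, HasDerivAt f 0 s) (hx : x ∈ Icc (-b) b) (hy : y ∈ Icc (-b) b) :
    f y = f x := by
  have := (convex_Icc (-b) b).norm_image_sub_le_of_norm_hasDerivWithin_le (f := f)
    (f' := fun _ => 0) (C := 0) (fun s hs => (hf s hs).hasDerivWithinAt) (by simp) hx hy
  rw [zero_mul, norm_le_zero_iff, sub_eq_zero] at this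
  exact this

theorem abs_le_of_hasDerivAt {f f' : ℝ → ℝ} {K : ℝ} (hK : 0 ≤ K) (h0 : f 0 = 0)
    (hf : ∀ s ∈ Icc (-(3 / 4) : ℝ) (3 / 4), HasDerivAt f (f' s) s)
    (hb : ∀ s ∈ Icc (-(3 / 4) : ℝ) (3 / 4), |f' s| ≤ K) {t : ℝ}
    (ht : t ∈ Icc (-(3 / 4) : ℝ) (3 / 4)) : |f t| ≤ K := by
  have := (convex_Icc (-(3 / 4) : ℝ) (3 / 4)).norm_image_sub_le_of_norm_hasDerivWithin_le (f := f)
    (f' := f') (C := K) (x := 0) (y := t) (fun s hs => (hf s hs).hasDerivWithinAt) hb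
    (by norm_num) ht
  rw [h0, sub_zero, sub_zero, Real.norm_eq_abs, Real.norm_eq_abs] at this
  have h1 : |t| ≤ 3 / 4 := abs_le.2 ht
  nlinarith [abs_nonneg t]

/-- A phase with vanishing second derivative in the first variable is affine in that variable. -/
theorem phase_boxPoint (hR : 0 < R) (hS : IsOpen S) (hφ : ContDiffOn ℝ ∞ φ S)
    (hbox : closedBox R v ⊆ S) (h2 : ∀ z ∈ S, mixedPartial 2 0 φ z = 0) {x t : ℝ}
    (hx : x ∈ Icc (-(3 / 4) : ℝ) (3 / 4)) (ht : t ∈ Icc (-(3 / 4) : ℝ) (3 / 4)) :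
    φ (boxPoint R v x t) =
      φ (boxPoint R v 0 t) + R⁻¹ * x * partialDeriv 0 φ (boxPoint R v 0 t) := by
  have hmem : ∀ s ∈ Icc (-(3 / 4) : ℝ) (3 / 4), boxPoint R v s t ∈ S := fun s hs =>
    hbox (boxPoint_mem_closedBox hR hs ht)
  have h0 : (0 : ℝ) ∈ Icc (-(3 / 4) : ℝ) (3 / 4) := by norm_num
  have d1 : ∀ s ∈ Icc (-(3 / 4) : ℝ) (3 / 4),
      HasDerivAt (fun s => partialDeriv 0 φ (boxPoint R v s t)) 0 s := fun s hs => by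
    have := hasDerivAt_boxPoint_left
      (differentiableAt_of_contDiffOn hS (hφ.partialDeriv hS 0) (hmem s hs))
    have e : partialDeriv 0 (partialDeriv 0 φ) (boxPoint R v s t) = 0 := h2 _ (hmem s hs)
    rwa [e, mul_zero] at this
  have c1 : ∀ s ∈ Icc (-(3 / 4) : ℝ) (3 / 4),
      partialDeriv 0 φ (boxPoint R v s t) = partialDeriv 0 φ (boxPoint R v 0 t) := fun s hs =>
    eq_of_forall_hasDerivAt_zero d1 h0 hs
  have d2 : ∀ s ∈ Icc (-(3 / 4) : ℝ) (3 / 4),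
      HasDerivAt (fun s => φ (boxPoint R v s t) -
        R⁻¹ * s * partialDeriv 0 φ (boxPoint R v 0 t)) 0 s := fun s hs => by
    have h1 := hasDerivAt_boxPoint_left (differentiableAt_of_contDiffOn hS hφ (hmem s hs))
    have h3 := ((hasDerivAt_id s).const_mul R⁻¹).mul_const (partialDeriv 0 φ (boxPoint R v 0 t))
    have := h1.sub h3
    rw [c1 s hs] at this
    convert! this using 1
    simp
  have := eq_of_forall_hasDerivAt_zero d2 h0 hx
  simp only [mul_zero, zero_mul, sub_zero] at this
  linarith

end AffinePhase

/-! ### Decay of a single packet -/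

/-- Decay of the extension of a profile away from its tube. -/
theorem exists_profile_decay {K : ℝ} (hK : 0 ≤ K) :
    ∃ C : ℝ, 0 ≤ C ∧ ∀ (δ κ R τ : ℝ) (S : Set Plane) (φ : Plane → ℝ) (v ξ : Plane)
      (k : Fin 2 → ℤ), 0 < δ → 1 ≤ κ → 1 / δ ≤ R → IsOpen S → ContDiffOn ℝ ∞ φ S →
      closedBox R v ⊆ S → (∀ z ∈ S, |mixedPartial 0 2 φ z| ≤ K * κ) →
      (∀ z ∈ S, |mixedPartial 1 1 φ z| ≤ K * κ) → (∀ z ∈ S, |mixedPartial 1 2 φ z| ≤ K * δ⁻¹) →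
      (∀ z ∈ S, mixedPartial 2 0 φ z = 0) → |τ| ≤ R ^ 2 / κ →
      ‖extOp S (fun _ => 1) φ (profile R v k) ξ τ‖ ≤ C * R⁻¹ *
        ((1 + |(ξ 0 - R * k 0 + τ * partialDeriv 0 φ v) / R|) ^ 2)⁻¹ *
        ((1 + |(ξ 1 - R * k 1 + τ * partialDeriv 1 φ v) / R|) ^ 2)⁻¹ := by
  obtain ⟨C, hC, hosc⟩ := exists_oscillatory_bound hK
  refine ⟨C, hC, fun δ κ R τ S φ v ξ k hδ hκ hδR hS hφ hbox h02 h11 h12 h20 hτ => ?_⟩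
  have hR : 0 < R := lt_of_lt_of_le (by positivity) hδR
  have hκ0 : 0 < κ := by linarith
  set a₁ := (ξ 0 - R * k 0 + τ * partialDeriv 0 φ v) / R with ha₁
  set a₂ := (ξ 1 - R * k 1 + τ * partialDeriv 1 φ v) / R with ha₂
  set γ : ℝ → Plane := fun t => boxPoint R v 0 t with hγ
  have hI0 : (0 : ℝ) ∈ Icc (-(3 / 4) : ℝ) (3 / 4) := by norm_num
  have hmem : ∀ t ∈ Icc (-(3 / 4) : ℝ) (3 / 4), γ t ∈ S := fun t ht =>
    hbox (boxPoint_mem_closedBox hR hI0 ht)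
  -- After rescaling, the phase minus its value at `v`, with the modulation absorbed, is `a₁x + a₂t
  -- + P(t) + xQ(t)`; the linear part at `v` has gone into `a₁` and `a₂`.
  set P : ℝ → ℝ := fun t => τ * (φ (γ t) - φ v - R⁻¹ * t * partialDeriv 1 φ v) with hP
  set P' : ℝ → ℝ := fun t => τ * (R⁻¹ * partialDeriv 1 φ (γ t) - R⁻¹ * partialDeriv 1 φ v) with hP'
  set P'' : ℝ → ℝ := fun t => τ * (R⁻¹ * (R⁻¹ * mixedPartial 0 2 φ (γ t))) with hP''
  set Q : ℝ → ℝ := fun t => τ * R⁻¹ * (partialDeriv 0 φ (γ t) - partialDeriv 0 φ v) with hQ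
  set Q' : ℝ → ℝ := fun t => τ * R⁻¹ * (R⁻¹ * mixedPartial 1 1 φ (γ t)) with hQ'
  set Q'' : ℝ → ℝ := fun t => τ * R⁻¹ * (R⁻¹ * (R⁻¹ * mixedPartial 1 2 φ (γ t))) with hQ''
  have s0 := hφ.partialDeriv hS 0
  have s1 := hφ.partialDeriv hS 1
  have s01 : ContDiffOn ℝ ∞ (mixedPartial 1 1 φ) S := s1.partialDeriv hS 0
  have s11 : ContDiffOn ℝ ∞ (mixedPartial 0 2 φ) S := s1.partialDeriv hS 1
  have s011 : ContDiffOn ℝ ∞ (mixedPartial 1 2 φ) S := s11.partialDeriv hS 0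
  have dP : ∀ t ∈ Icc (-(3 / 4) : ℝ) (3 / 4), HasDerivAt P (P' t) t := fun t ht => by
    have h1 := hasDerivAt_boxPoint_right (differentiableAt_of_contDiffOn hS hφ (hmem t ht))
    have h2 := ((hasDerivAt_id t).const_mul R⁻¹).mul_const (partialDeriv 1 φ v)
    have := ((h1.sub_const (φ v)).sub h2).const_mul τ
    rw [mul_one] at this
    exact this
  have dP' : ∀ t ∈ Icc (-(3 / 4) : ℝ) (3 / 4), HasDerivAt P' (P'' t) t := fun t ht => by
    have h1 := hasDerivAt_boxPoint_right (differentiableAt_of_contDiffOn hS s1 (hmem t ht))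
    exact ((h1.const_mul R⁻¹).sub_const _).const_mul τ
  have dQ : ∀ t ∈ Icc (-(3 / 4) : ℝ) (3 / 4), HasDerivAt Q (Q' t) t := fun t ht => by
    have h1 := hasDerivAt_boxPoint_right (differentiableAt_of_contDiffOn hS s0 (hmem t ht))
    rw [partialDeriv_comm hS hφ (hmem t ht)] at h1
    exact (h1.sub_const _).const_mul (τ * R⁻¹)
  have dQ' : ∀ t ∈ Icc (-(3 / 4) : ℝ) (3 / 4), HasDerivAt Q' (Q'' t) t := fun t ht => by
    have h1 := hasDerivAt_boxPoint_right (differentiableAt_of_contDiffOn hS s01 (hmem t ht))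
    have e : partialDeriv 1 (mixedPartial 1 1 φ) (γ t) = mixedPartial 1 2 φ (γ t) :=
      partialDeriv_comm hS s1 (hmem t ht) 1 0
    rw [e] at h1
    exact (h1.const_mul R⁻¹).const_mul (τ * R⁻¹)
  have hτ' : |τ| * κ ≤ R ^ 2 := (le_div_iff₀ hκ0).1 hτ
  have hδR' : δ⁻¹ ≤ R := by simpa using hδR
  have bP'' : ∀ t ∈ Icc (-(3 / 4) : ℝ) (3 / 4), |P'' t| ≤ K := fun t ht => by
    rw [hP'', abs_mul, abs_mul, abs_mul, abs_of_pos (inv_pos.2 hR)]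
    calc |τ| * (R⁻¹ * (R⁻¹ * |mixedPartial 0 2 φ (γ t)|))
        ≤ |τ| * (R⁻¹ * (R⁻¹ * (K * κ))) := by gcongr; exact h02 _ (hmem t ht)
      _ = K * (R⁻¹ ^ 2 * (|τ| * κ)) := by ring
      _ ≤ K * (R⁻¹ ^ 2 * R ^ 2) := by gcongr
      _ = K := by field_simp
  have bQ' : ∀ t ∈ Icc (-(3 / 4) : ℝ) (3 / 4), |Q' t| ≤ K := fun t ht => by
    rw [hQ', abs_mul, abs_mul, abs_mul, abs_of_pos (inv_pos.2 hR)]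
    calc |τ| * R⁻¹ * (R⁻¹ * |mixedPartial 1 1 φ (γ t)|)
        ≤ |τ| * R⁻¹ * (R⁻¹ * (K * κ)) := by gcongr; exact h11 _ (hmem t ht)
      _ = K * (R⁻¹ ^ 2 * (|τ| * κ)) := by ring
      _ ≤ K * (R⁻¹ ^ 2 * R ^ 2) := by gcongr
      _ = K := by field_simp
  -- For `Q''` the third derivative is only bounded by `K/δ ≤ KR`, so `κ ≥ 1` is used to drop `κ`,
  -- and the powers of `R` cancel.
  have hτ1 : |τ| ≤ R ^ 2 := by nlinarith [abs_nonneg τ]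
  have bQ'' : ∀ t ∈ Icc (-(3 / 4) : ℝ) (3 / 4), |Q'' t| ≤ K := fun t ht => by
    rw [hQ'', abs_mul, abs_mul, abs_mul, abs_mul, abs_of_pos (inv_pos.2 hR)]
    calc |τ| * R⁻¹ * (R⁻¹ * (R⁻¹ * |mixedPartial 1 2 φ (γ t)|))
        ≤ R ^ 2 * R⁻¹ * (R⁻¹ * (R⁻¹ * (K * R))) := by
          gcongr
          exact (h12 _ (hmem t ht)).trans (by gcongr)
      _ = K := by field_simp
  have hγ0 : γ 0 = v := boxPoint_zero
  -- `P'` and `Q` vanish at `t = 0`, the centre of the square, so they inherit the bounds of their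
  -- derivatives on an interval of radius below one.
  have bP' : ∀ t ∈ Icc (-(3 / 4) : ℝ) (3 / 4), |P' t| ≤ K := fun t ht =>
    abs_le_of_hasDerivAt hK (by simp only [hP', hγ0]; ring) dP' bP'' ht
  have bQ : ∀ t ∈ Icc (-(3 / 4) : ℝ) (3 / 4), |Q t| ≤ K := fun t ht =>
    abs_le_of_hasDerivAt hK (by simp only [hQ, hγ0]; ring) dQ bQ' ht
  have hγc : ContinuousOn γ (Icc (-(3 / 4)) (3 / 4)) := continuous_boxPoint_right.continuousOn
  have cP'' : ContinuousOn P'' (Icc (-(3 / 4)) (3 / 4)) :=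
    continuousOn_const.mul (continuousOn_const.mul
      (continuousOn_const.mul (s11.continuousOn.comp hγc hmem)))
  have cQ'' : ContinuousOn Q'' (Icc (-(3 / 4)) (3 / 4)) :=
    continuousOn_const.mul (continuousOn_const.mul (continuousOn_const.mul
      (s011.continuousOn.comp hγc hmem)))
  have hJ := hosc P P' P'' Q Q' Q''
    (fun t ht => ⟨dP t ht, dP' t ht, dQ t ht, dQ' t ht⟩) cP'' cQ''
    (fun t ht => ⟨bP' t ht, bP'' t ht, bQ t ht, bQ' t ht, bQ'' t ht⟩) a₁ a₂
  set Φ : Plane → ℂ := fun z => profile R v k z *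
    Complex.exp (-(Complex.I * ((ξ 0 * z 0 + ξ 1 * z 1 + τ * φ z : ℝ) : ℂ))) with hΦ
  have hsupp := (tsupport_profile_subset (R := R) (v := v) k).trans hbox
  have hΦi : MemLp Φ 1 := memLp_extOp_integrand hS hφ (contDiff_profile k)
    (hasCompactSupport_profile hR k) hsupp ξ τ 1
  have hΦ0 : ∀ z ∉ closedBox R v, Φ z = 0 := fun z hz => by
    simp only [hΦ, profile_eq_zero k hz, zero_mul]
  have hchange := integral_add_smul (s := R⁻¹) (inv_pos.2 hR) v Φ
  rw [integral_plane_eq (memLp_one_iff_integrable.1 (hΦi.add_smul (inv_pos.2 hR) v))] at hchange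
  simp only [finrank_euclideanSpace, Fintype.card_fin] at hchange
  set c : ℂ := Complex.exp (-(Complex.I * ((ξ 0 * v 0 + ξ 1 * v 1 + τ * φ v : ℝ) : ℂ))) with hc
  set J : ℝ → ℂ := fun t => ((lineBump t : ℂ) * (lineBumpFourier (a₁ + Q t) *
        Complex.exp (-(Complex.I * (P t : ℂ))))) * Complex.exp (-(Complex.I * ((a₂ * t : ℝ) : ℂ)))
    with hJdef
  have hinner : ∀ t ∈ Icc (-(3 / 4) : ℝ) (3 / 4),
      ∫ x, Φ (boxPoint R v x t) = R * c * J t := fun t ht => by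
    have e : ∀ x, Φ (boxPoint R v x t) = (R * c * (lineBump t * (Complex.exp (-(Complex.I * (P t : ℂ)))
        * Complex.exp (-(Complex.I * ((a₂ * t : ℝ) : ℂ)))))) *
        ((lineBump x : ℂ) * Complex.exp (-(Complex.I * (((a₁ + Q t) * x : ℝ) : ℂ)))) := fun x => by
      -- The affine formula for the phase is available only inside the square; outside it the bump
      -- kills both sides.
      by_cases hx : x ∈ Icc (-(3 / 4) : ℝ) (3 / 4)
      · have hph := phase_boxPoint hR hS hφ hbox h20 hx ht
        simp only [hΦ, profile, window, boxPoint_apply_zero, boxPoint_apply_one,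
          add_sub_cancel_left, mul_inv_cancel_left₀ hR.ne', hph, hc]
        have e1 : ∀ A B X Y Z W V : ℂ, (R : ℂ) * (Complex.exp X) * (A * (Complex.exp Y *
          Complex.exp Z)) * (B * Complex.exp W) =
          (R * (B * A)) * Complex.exp (X + Y + Z + W) := fun A B X Y Z W V => by
            simp only [Complex.exp_add]; ring
        rw [e1 _ _ _ _ _ _ 0, mul_assoc, ← Complex.exp_add]
        push_cast
        congr 2
        simp only [hP, hQ, ha₁, ha₂, hγ]
        push_cast
        field_simp
        ring
      · have h1 : lineBump x = 0 := lineBump_eq_zero (by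
          rw [mem_Icc, ← abs_le, not_le] at hx
          exact hx.le)
        simp [hΦ, profile, window, boxPoint_apply_zero, boxPoint_apply_one,
          mul_inv_cancel_left₀ hR.ne', h1]
    simp_rw [e]
    rw [integral_const_mul, ← lineBumpFourier_apply]
    simp only [hJdef]
    ring
  have houter : ∀ t ∉ Icc (-(3 / 4) : ℝ) (3 / 4), ∫ x, Φ (boxPoint R v x t) = 0 := fun t ht => by
    have : ∀ x, Φ (boxPoint R v x t) = 0 := fun x => hΦ0 _ fun h => ht (by
      have := h 1
      rwa [boxPoint_apply_one, add_sub_cancel_left, mul_inv_cancel_left₀ hR.ne', abs_le] at this)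
    simp [this]
  have htotal : ∫ t : ℝ, ∫ x : ℝ, Φ (boxPoint R v x t) =
      R * c * ∫ t in -(3 / 4 : ℝ)..(3 / 4), J t := by
    rw [← setIntegral_eq_integral_of_forall_compl_eq_zero houter,
      setIntegral_congr_fun measurableSet_Icc hinner, integral_const_mul,
      integral_Icc_eq_integral_Ioc, intervalIntegral.integral_of_le (by norm_num)]
  -- The amplitude `R` against the Jacobian `R⁻²` leaves the factor `R⁻¹` of (P3).
  have hfinal : extOp S (fun _ => 1) φ (profile R v k) ξ τ =
      ((R⁻¹ : ℝ) : ℂ) * c * ∫ t in -(3 / 4 : ℝ)..(3 / 4), J t := by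
    rw [extOp_one_eq_integral hsupp]
    have h1 : ∫ z, Φ z = ((R⁻¹ ^ 2 : ℝ) : ℂ) * ∫ t : ℝ, ∫ x : ℝ, Φ (boxPoint R v x t) := by
      have h2 : ∫ t : ℝ, ∫ x : ℝ, Φ (boxPoint R v x t) =
          (((R⁻¹ ^ 2)⁻¹ : ℝ) : ℂ) * ∫ z, Φ z := hchange
      rw [h2, ← mul_assoc, ← Complex.ofReal_mul, mul_inv_cancel₀ (by positivity),
        Complex.ofReal_one, one_mul]
    rw [h1, htotal]
    have hRc : (R : ℂ) ≠ 0 := by exact_mod_cast hR.ne'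
    push_cast
    field_simp
  have hcn : ‖c‖ = 1 := norm_exp_neg_I_mul _
  rw [hfinal, norm_mul, norm_mul, hcn, mul_one, Complex.norm_real,
    Real.norm_of_nonneg (by positivity)]
  calc R⁻¹ * ‖∫ t in -(3 / 4 : ℝ)..(3 / 4), J t‖
      ≤ R⁻¹ * (C * ((1 + |a₁|) ^ 2)⁻¹ * ((1 + |a₂|) ^ 2)⁻¹) := by gcongr
    _ = _ := by ring

/-! ### Packets, tiles and coefficients -/

/-- The square of side `1 / R` around `R⁻¹ l` meets `U`. -/
def IsActive (R : ℝ) (U : Set Plane) (l : Fin 2 → ℤ) : Prop :=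
  ∃ z ∈ U, ∀ i, |R * (z i - latticePoint R l i)| ≤ 1 / 2

open Classical in
/-- The profile of the packet with indices `k` and `l`, zero away from `U`. -/
noncomputable def packetProfile (R : ℝ) (U : Set Plane) (k l : Fin 2 → ℤ) : Plane → ℂ :=
  if IsActive R U l then profile R (latticePoint R l) k else 0

/-- The half-open squares of side `1 / R` around the points `R⁻¹ l`, which tile the plane. -/
def latticeCell (R : ℝ) (l : Fin 2 → ℤ) : Set Plane := {z | ∀ i, ⌊R * z i + 1 / 2⌋ = l i}

/-- The coefficient of the packet with indices `k` and `l`. -/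
noncomputable def packetCoeff (R : ℝ) (h : Plane → ℂ) (k l : Fin 2 → ℤ) : ℂ :=
  ((R / (2 * Real.pi) ^ 2 : ℝ) : ℂ) *
    boxCoeff R (latticePoint R l) (fun z => (latticeCell R l).indicator 1 z * h z) k

section Active

variable {R δ A : ℝ} {U : Set Plane} {k l : Fin 2 → ℤ}

/-- Some point of `U` lies within `1/R` of the lattice point, so the ball stays within `3/R ≤ 3δ <
Aδ` of `U`; this is where `A ≥ 4` enters. -/
theorem IsActive.ball_subset (hl : IsActive R U l) (hR : 0 < R) (hδ : 0 < δ) (hA : 4 ≤ A)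
    (hδR : 1 / δ ≤ R) : ball (latticePoint R l) (2 / R) ⊆ thickening (A * δ) U := by
  obtain ⟨u, hu, hul⟩ := hl
  intro z hz
  rw [mem_thickening_iff]
  refine ⟨u, hu, ?_⟩
  have h1 : ‖u - latticePoint R l‖ ≤ 1 / R := by
    refine le_of_sq_le_sq ((norm_sub_sq_le hR hul).trans ?_) (by positivity)
    rw [show 2 * (1 / 2 / R) ^ 2 = 1 / 2 * (1 / R) ^ 2 by ring]
    linarith [sq_nonneg (1 / R)]
  have h2 : 1 / R ≤ δ := by
    rw [div_le_iff₀ hR, mul_comm]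
    exact (div_le_iff₀ hδ).1 hδR
  rw [mem_ball] at hz
  have h3 := dist_triangle_right z u (latticePoint R l)
  rw [dist_eq_norm u] at h3
  have h4 : 2 / R = 2 * (1 / R) := by ring
  nlinarith

theorem packetProfile_of_isActive (hl : IsActive R U l) :
    packetProfile R U k l = profile R (latticePoint R l) k := if_pos hl

theorem packetProfile_of_not_isActive (hl : ¬IsActive R U l) : packetProfile R U k l = 0 :=
  if_neg hl

theorem contDiff_packetProfile : ContDiff ℝ ∞ (packetProfile R U k l) := by
  by_cases hl : IsActive R U l
  · rw [packetProfile_of_isActive hl]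
    exact contDiff_profile k
  · rw [packetProfile_of_not_isActive hl]
    exact contDiff_const

theorem hasCompactSupport_packetProfile (hR : 0 < R) :
    HasCompactSupport (packetProfile R U k l) := by
  by_cases hl : IsActive R U l
  · rw [packetProfile_of_isActive hl]
    exact hasCompactSupport_profile hR k
  · rw [packetProfile_of_not_isActive hl]
    exact HasCompactSupport.zero

theorem mem_tsupport_packetProfile {z : Plane} (hz : z ∈ tsupport (packetProfile R U k l)) :
    IsActive R U l ∧ z ∈ closedBox R (latticePoint R l) := by
  by_cases hl : IsActive R U l
  · rw [packetProfile_of_isActive hl] at hz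
    exact ⟨hl, tsupport_profile_subset k hz⟩
  · rw [packetProfile_of_not_isActive hl] at hz
    simp [tsupport] at hz

theorem closedBox_subset_ball {v : Plane} (hR : 0 < R) : closedBox R v ⊆ ball v (2 / R) :=
  fun z hz => by
    rw [mem_ball, dist_eq_norm]
    exact (norm_sub_lt_of_mem_closedBox hR hz).trans_le (by gcongr; norm_num)

theorem tsupport_packetProfile_subset (hR : 0 < R) (hδ : 0 < δ) (hA : 4 ≤ A) (hδR : 1 / δ ≤ R) :
    tsupport (packetProfile R U k l) ⊆ thickening (A * δ) U := fun _ hz =>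
  (mem_tsupport_packetProfile hz).1.ball_subset hR hδ hA hδR
    (closedBox_subset_ball hR (mem_tsupport_packetProfile hz).2)

theorem finite_isActive (hR : 0 < R) (hU : Bornology.IsBounded U) :
    {l | IsActive R U l}.Finite := by
  obtain ⟨B, hB⟩ := hU.exists_norm_le
  refine (Set.finite_Icc (fun _ => -⌈R * B + 1 / 2⌉) (fun _ => ⌈R * B + 1 / 2⌉)).subset ?_
  rintro l ⟨z, hz, hzl⟩
  have h : ∀ i, |(l i : ℝ)| ≤ ⌈R * B + 1 / 2⌉ := fun i => by
    have h1 := hzl i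
    rw [latticePoint, mul_sub, mul_inv_cancel_left₀ hR.ne'] at h1
    have h2 : |z i| ≤ B := (PiLp.norm_apply_le z i).trans (hB z hz)
    have h3 : |(l i : ℝ)| ≤ |R * z i - l i| + |R * z i| := by
      have := abs_sub (R * z i) (R * z i - l i)
      rw [sub_sub_cancel] at this
      linarith
    rw [abs_mul, abs_of_pos hR] at h3
    have h4 := Int.le_ceil (R * B + 1 / 2)
    nlinarith
  refine ⟨fun i => ?_, fun i => ?_⟩
  · have := (abs_le.1 (h i)).1
    exact_mod_cast this
  · have := (abs_le.1 (h i)).2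
    exact_mod_cast this

end Active

section Cells

variable {R : ℝ} {U : Set Plane} {l : Fin 2 → ℤ} {z : Plane}

theorem abs_sub_le_of_mem_latticeCell (hR : 0 < R) (hz : z ∈ latticeCell R l) (i : Fin 2) :
    |R * (z i - latticePoint R l i)| ≤ 1 / 2 := by
  rw [latticePoint, mul_sub, mul_inv_cancel_left₀ hR.ne', ← hz i, abs_le]
  have h1 := Int.floor_le (R * z i + 1 / 2)
  have h2 := Int.lt_floor_add_one (R * z i + 1 / 2)
  constructor <;> linarith

theorem measurableSet_latticeCell : MeasurableSet (latticeCell R l) := by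
  have : latticeCell R l = ⋂ i, (fun z : Plane => ⌊R * z i + 1 / 2⌋) ⁻¹' {l i} := by
    ext z
    simp [latticeCell]
  rw [this]
  refine MeasurableSet.iInter fun i => ?_
  have h : Measurable fun z : Plane => R * z i + 1 / 2 := Continuous.measurable (by fun_prop)
  exact (Int.measurable_floor.comp h) (measurableSet_singleton _)

/-- Bessel's inequality for the indicators of the tiles gives the total constant `1/π² ≤ 1`. -/
theorem tsum_packetCoeff_le (hR : 0 < R) {h : Plane → ℂ} (hh : MemLp h 2) :
    ∑' p : (Fin 2 → ℤ) × (Fin 2 → ℤ), ‖packetCoeff R h p.1 p.2‖ₑ ^ 2 ≤ ∫⁻ z, ‖h z‖ₑ ^ 2 := by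
  have key := tsum_boxCoeff_window_le hR (m := fun l => (latticeCell R l).indicator 1) (h := h)
    (fun l => measurable_one.indicator measurableSet_latticeCell)
    (fun l z => by
      by_cases hz : z ∈ latticeCell R l <;> simp [hz])
    (fun l z hz => indicator_of_notMem (fun hz' => hz fun i =>
      (abs_sub_le_of_mem_latticeCell hR hz' i).trans_lt (by norm_num)) _) hh
  have e : ∀ p : (Fin 2 → ℤ) × (Fin 2 → ℤ), ‖packetCoeff R h p.1 p.2‖ₑ ^ 2 =
      ENNReal.ofReal ((R / (2 * Real.pi) ^ 2) ^ 2) * ‖boxCoeff R (latticePoint R p.2)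
        (fun z => (latticeCell R p.2).indicator 1 z * h z) p.1‖ₑ ^ 2 := fun p => by
    rw [packetCoeff, enorm_mul, mul_pow, enorm_sq_eq_ofReal (Complex.ofReal _), Complex.norm_real,
      Real.norm_of_nonneg (by positivity)]
  simp_rw [e]
  rw [ENNReal.tsum_mul_left]
  refine (mul_le_mul_right key _).trans ?_
  rw [show (4 : ℝ≥0∞) = ENNReal.ofReal 4 by norm_num, ← mul_assoc, ← mul_assoc,
    ← ENNReal.ofReal_mul (by positivity), ← ENNReal.ofReal_mul (by positivity)]
  refine mul_le_of_le_one_left' (ENNReal.ofReal_le_one.2 ?_)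
  have : (R / (2 * Real.pi) ^ 2) ^ 2 * (2 * Real.pi / R) ^ 2 * 4 = (Real.pi ^ 2)⁻¹ := by
    field_simp
    ring
  rw [this]
  exact inv_le_one_of_one_le₀ (one_le_pow₀ (by linarith [Real.pi_gt_three]))

end Cells

/-! ### The decomposition formula -/

section Decomposition

variable {R : ℝ} {U S : Set Plane} {φ : Plane → ℝ} {h : Plane → ℂ}

/-- The modulation of the profile serves as the Fourier character, so a packet evaluated at a point
is itself a Fourier coefficient of window times phase. Its sign gives `-k`, as the bilinear Parseval
identity requires. -/
theorem extOp_profile_eq_boxCoeff (v : Plane) (hS : closedBox R v ⊆ S) (k : Fin 2 → ℤ)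
    (ξ : Plane) (τ : ℝ) : extOp S (fun _ => 1) φ (profile R v k) ξ τ =
      R * boxCoeff R v (fun z => (window R v z : ℂ) *
        Complex.exp (-(Complex.I * ((ξ 0 * z 0 + ξ 1 * z 1 + τ * φ z : ℝ) : ℂ)))) (-k) := by
  rw [extOp_one_eq_integral ((tsupport_profile_subset k).trans hS), boxCoeff, ← integral_const_mul]
  refine integral_congr_ae (ae_of_all _ fun z => ?_)
  simp only [profile, Complex.ofReal_mul, Pi.neg_apply]
  push_cast
  rw [show -(Complex.I * (R * (-(k 0 : ℂ) * (z 0 - v 0) + -(k 1 : ℂ) * (z 1 - v 1)))) =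
    Complex.I * (R * ((k 0 : ℂ) * (z 0 - v 0) + (k 1 : ℂ) * (z 1 - v 1))) by ring]
  ring

theorem memLp_window_mul_exp (hR : 0 < R) {v : Plane} (hS : IsOpen S) (hφ : ContDiffOn ℝ ∞ φ S)
    (hv : closedBox R v ⊆ S) (ξ : Plane) (τ : ℝ) :
    MemLp (fun z => (window R v z : ℂ) *
      Complex.exp (-(Complex.I * ((ξ 0 * z 0 + ξ 1 * z 1 + τ * φ z : ℝ) : ℂ)))) 2 := by
  have hsub : tsupport (fun z => (window R v z : ℂ)) ⊆ closedBox R v :=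
    closure_minimal (fun z hz => by_contra fun h => hz (by simp [window_eq_zero h]))
      isClosed_closedBox
  exact memLp_extOp_integrand hS hφ (Complex.ofRealCLM.contDiff.comp contDiff_window)
    ((isCompact_closedBox hR).of_isClosed_subset (isClosed_tsupport _) hsub) (hsub.trans hv) ξ τ 2

/-- The contribution of one cell to the extension is the sum of the packets over that cell. -/
theorem hasSum_packet_cell (hR : 0 < R) (hS : IsOpen S) (hφ : ContDiffOn ℝ ∞ φ S)
    (hact : ∀ l, IsActive R U l → closedBox R (latticePoint R l) ⊆ S) (hh : MemLp h 2)
    (hhU : ∀ z ∉ U, h z = 0) (ξ : Plane) (τ : ℝ) (l : Fin 2 → ℤ) :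
    let H := fun z => (latticeCell R l).indicator 1 z * h z *
      Complex.exp (-(Complex.I * ((ξ 0 * z 0 + ξ 1 * z 1 + τ * φ z : ℝ) : ℂ)))
    Integrable H ∧ HasSum (fun k => packetCoeff R h k l *
      extOp S (fun _ => 1) φ (packetProfile R U k l) ξ τ) (∫ z, H z) := by
  intro H
  by_cases hl : IsActive R U l
  · have hH : MemLp (fun z => (latticeCell R l).indicator 1 z * h z) 2 :=
      hh.of_le ((measurable_one.indicator measurableSet_latticeCell).aestronglyMeasurable.mul hh.1)
        (ae_of_all _ fun z => by
          by_cases hz : z ∈ latticeCell R l <;> simp [hz])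
    have hG := memLp_window_mul_exp hR hS hφ (hact l hl) ξ τ
    -- The window is one on the tile, so inserting it leaves the integrand unchanged.
    have hHG : ∀ z, (latticeCell R l).indicator 1 z * h z * ((window R (latticePoint R l) z : ℂ) *
        Complex.exp (-(Complex.I * ((ξ 0 * z 0 + ξ 1 * z 1 + τ * φ z : ℝ) : ℂ)))) = H z := by
      intro z
      by_cases hz : z ∈ latticeCell R l
      · rw [window_eq_one (abs_sub_le_of_mem_latticeCell hR hz), Complex.ofReal_one, one_mul]
      · simp only [H, indicator_of_notMem hz, zero_mul]
    refine ⟨(hH.integrable_mul hG).congr (ae_of_all _ hHG), ?_⟩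
    have key := hasSum_boxCoeff (v := latticePoint R l) hR hH hG
      (fun z hz => by
        rw [indicator_of_notMem (fun hz' => hz fun i =>
          (abs_sub_le_of_mem_latticeCell hR hz' i).trans_lt (by norm_num)), zero_mul])
      (fun z hz => by
        rw [window_eq_zero fun hz' => hz (closedBox_subset_openBox hz'), Complex.ofReal_zero,
          zero_mul])
    rw [integral_congr_ae (ae_of_all _ hHG)] at key
    -- Parseval yields `(2π/R)²` times the integral. Its inverse splits as the packet factor `R`
    -- times `R/(2π)²`, which is the normalisation in `packetCoeff`.
    have key' := key.mul_left (((R / (2 * Real.pi)) ^ 2 : ℝ) : ℂ)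
    have hone : (R / (2 * Real.pi)) ^ 2 * (2 * Real.pi / R) ^ 2 = 1 := by field_simp
    rw [← mul_assoc, ← Complex.ofReal_mul, hone, Complex.ofReal_one, one_mul] at key'
    refine key'.congr_fun fun k => ?_
    rw [packetProfile_of_isActive hl, extOp_profile_eq_boxCoeff _ (hact l hl), packetCoeff]
    push_cast
    ring
  -- If the square misses `U`, then `h` vanishes on the tile, and the coefficients and the integral
  -- are all zero.
  · have h0 : ∀ z, (latticeCell R l).indicator 1 z * h z = 0 := fun z => by
      by_cases hz : z ∈ latticeCell R l
      · rw [hhU z (fun hzU => hl ⟨z, hzU, abs_sub_le_of_mem_latticeCell hR hz⟩), mul_zero]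
      · rw [indicator_of_notMem hz, zero_mul]
    have hH0 : H = 0 := by
      funext z
      simp only [H, h0, zero_mul, Pi.zero_apply]
    rw [hH0]
    refine ⟨integrable_zero _ _ _, ?_⟩
    have e : (fun k => packetCoeff R h k l *
      extOp S (fun _ => 1) φ (packetProfile R U k l) ξ τ) = fun _ => 0 := by
      funext k
      simp [packetCoeff, boxCoeff, h0]
    rw [e]
    simp

/-- Parseval gives unconditional convergence over frequencies for each fixed tile; finitely many
nonzero tiles make the joint sum unconditional. -/
theorem hasSum_of_finite_fibers {a : (Fin 2 → ℤ) × (Fin 2 → ℤ) → ℂ} {b : (Fin 2 → ℤ) → ℂ}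
    (s : Finset (Fin 2 → ℤ)) (ha : ∀ l, HasSum (fun k => a (k, l)) (b l))
    (h0 : ∀ k, ∀ l ∉ s, a (k, l) = 0) : HasSum a (∑ l ∈ s, b l) := by
  classical
  have h1 : ∀ l ∈ s, HasSum (fun p : (Fin 2 → ℤ) × (Fin 2 → ℤ) => if p.2 = l then a p else 0)
      (b l) := fun l _ => by
    have hinj : Function.Injective fun k : Fin 2 → ℤ => (k, l) := fun k k' h => (Prod.ext_iff.1 h).1
    refine (hinj.hasSum_iff fun p hp => if_neg fun h => hp ⟨p.1, ?_⟩).1 ?_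
    · rw [← h]
    · simpa [Function.comp_def] using ha l
  refine (hasSum_sum h1).congr_fun fun p => ?_
  rw [Finset.sum_ite_eq]
  split_ifs with hp
  · rfl
  · exact h0 p.1 p.2 hp

theorem hasSum_packet (hR : 0 < R) (hU : Bornology.IsBounded U) (hS : IsOpen S)
    (hφ : ContDiffOn ℝ ∞ φ S)
    (hact : ∀ l, IsActive R U l → closedBox R (latticePoint R l) ⊆ S) (hh : MemLp h 2)
    (hhU : ∀ z ∉ U, h z = 0) (ξ : Plane) (τ : ℝ) :
    HasSum (fun p : (Fin 2 → ℤ) × (Fin 2 → ℤ) => packetCoeff R h p.1 p.2 *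
      extOp S (fun _ => 1) φ (packetProfile R U p.1 p.2) ξ τ)
      (∫ z, h z * Complex.exp (-(Complex.I * ((ξ 0 * z 0 + ξ 1 * z 1 + τ * φ z : ℝ) : ℂ)))) := by
  have hfin := finite_isActive hR hU
  have key := hasSum_of_finite_fibers (a := fun p => packetCoeff R h p.1 p.2 *
      extOp S (fun _ => 1) φ (packetProfile R U p.1 p.2) ξ τ) hfin.toFinset
    (fun l => (hasSum_packet_cell hR hS hφ hact hh hhU ξ τ l).2) (fun k l hl => by
      rw [Set.Finite.mem_toFinset] at hl
      simp only [packetProfile_of_not_isActive hl]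
      simp [extOp])
  rw [← integral_finsetSum _ fun l _ => (hasSum_packet_cell hR hS hφ hact hh hhU ξ τ l).1] at key
  convert key using 1
  refine integral_congr_ae (ae_of_all _ fun z => ?_)
  simp only
  rw [← Finset.sum_mul, ← Finset.sum_mul]
  congr 1
  by_cases hz : z ∈ U
  -- A point lies in exactly one tile, found by rounding its coordinates; if the point is in `U`,
  -- that tile is active.
  · have hz0 : z ∈ latticeCell R fun i => ⌊R * z i + 1 / 2⌋ := fun i => rfl
    rw [Finset.sum_eq_single fun i => ⌊R * z i + 1 / 2⌋, indicator_of_mem hz0, Pi.one_apply, one_mul]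
    · exact fun l _ hl => indicator_of_notMem (fun h => hl (funext fun i => (h i).symm)) _
    · intro hn
      rw [Set.Finite.mem_toFinset] at hn
      exact absurd ⟨z, hz, abs_sub_le_of_mem_latticeCell hR hz0⟩ hn
  · rw [hhU z hz, mul_zero]

end Decomposition

/-! ### Indexing and properties of the packets -/

section PacketIndex

variable {R δ A : ℝ} {U S : Set Plane} {φ : Plane → ℝ}

/-- The integer coordinates of an index `(η, v)`, scaled by `R⁻¹` and `R` respectively. -/
theorem exists_packetIndex_coords (hR : 0 < R) (S : Set Plane) :
    ∃ ι : packetIndex R S → (Fin 2 → ℤ) × (Fin 2 → ℤ), Function.Injective ι ∧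
      (∀ w, (∀ i, w.1.1 i = R * (ι w).1 i) ∧ w.1.2 = latticePoint R (ι w).2) ∧
      ∀ k l, latticePoint R l ∈ S → (k, l) ∈ range ι := by
  have hex : ∀ w : packetIndex R S, ∃ p : (Fin 2 → ℤ) × (Fin 2 → ℤ),
      (∀ i, w.1.1 i = R * p.1 i) ∧ w.1.2 = latticePoint R p.2 := fun w => by
    obtain ⟨⟨k, hk⟩, ⟨l, hl⟩, -⟩ := w.2
    exact ⟨(k, l), hk, by ext i; exact hl i⟩
  choose ι hι using hex
  refine ⟨ι, fun w w' h => ?_, hι, fun k l hl => ?_⟩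
  · refine Subtype.ext (Prod.ext ?_ ?_)
    · ext i
      rw [(hι w).1 i, (hι w').1 i, h]
    · rw [(hι w).2, (hι w').2, h]
  · set w : packetIndex R S := ⟨(WithLp.toLp 2 fun i => R * k i, latticePoint R l),
      ⟨k, fun _ => rfl⟩, ⟨l, fun _ => rfl⟩, hl⟩ with hw
    refine ⟨w, Prod.ext (funext fun i => ?_) (funext fun i => ?_)⟩
    · have h : R * (k i : ℝ) = R * (ι w).1 i := (hι w).1 i
      exact_mod_cast (mul_left_cancel₀ hR.ne' h).symm
    · have h : R⁻¹ * (l i : ℝ) = R⁻¹ * (ι w).2 i := congrArg (fun z : Plane => z i) (hι w).2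
      exact_mod_cast (mul_left_cancel₀ (inv_ne_zero hR.ne') h).symm

theorem eLpNorm_two_eq {X : Type*} [MeasurableSpace X] {μ : Measure X} (f : X → ℂ) :
    eLpNorm f 2 μ = (∫⁻ x, ‖f x‖ₑ ^ 2 ∂μ) ^ (1 / 2 : ℝ) := by
  rw [eLpNorm_eq_lintegral_rpow_enorm_toReal (by norm_num) (by norm_num)]
  simp

theorem eLpNorm_two_le {X : Type*} [MeasurableSpace X] {μ : Measure X} {f : X → ℂ} {C : ℝ}
    (hC : 0 ≤ C) (h : ∫⁻ x, ‖f x‖ₑ ^ 2 ∂μ ≤ ENNReal.ofReal (C ^ 2)) :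
    eLpNorm f 2 μ ≤ ENNReal.ofReal C := by
  rw [eLpNorm_two_eq]
  refine (ENNReal.rpow_le_rpow h (by norm_num)).trans (le_of_eq ?_)
  rw [ENNReal.ofReal_rpow_of_nonneg (by positivity) (by norm_num), ← Real.sqrt_eq_rpow,
    Real.sqrt_sq hC]

theorem tsupport_finsetSum_subset {ι : Type*} (W : Finset ι) (g : ι → Plane → ℂ) :
    tsupport (fun z => ∑ w ∈ W, g w z) ⊆ ⋃ w ∈ W, tsupport (g w) := by
  refine closure_minimal (fun z hz => ?_)
    (W.finite_toSet.isClosed_biUnion fun w _ => isClosed_tsupport (g w))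
  obtain ⟨w, hw, hwz⟩ := Finset.exists_ne_zero_of_sum_ne_zero (Function.mem_support.1 hz)
  exact mem_biUnion hw (subset_tsupport _ hwz)

/-- Almost orthogonality of the packets at each time. -/
theorem eLpNorm_sum_packet_le (hR : 0 < R) (hS : IsOpen S) (hφ : ContDiffOn ℝ ∞ φ S)
    (hsupp : ∀ k l, tsupport (packetProfile R U k l) ⊆ S)
    (W : Finset ((Fin 2 → ℤ) × (Fin 2 → ℤ))) (τ : ℝ) :
    eLpNorm (fun ξ => ∑ p ∈ W, extOp S (fun _ => 1) φ (packetProfile R U p.1 p.2) ξ τ) 2 volume ≤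
      ENNReal.ofReal (8 * Real.pi ^ 2 * Real.sqrt W.card) := by
  classical
  refine eLpNorm_two_le (by positivity) ?_
  simp_rw [extOp_one_sum W hS hφ (fun p => contDiff_packetProfile (k := p.1) (l := p.2))
    (fun p => hasCompactSupport_packetProfile hR) (fun p => hsupp p.1 p.2)]
  set W' := W.filter fun p => IsActive R U p.2 with hW'
  have e : (fun z => ∑ p ∈ W, packetProfile R U p.1 p.2 z) =
      fun z => ∑ p ∈ W', profile R (latticePoint R p.2) p.1 z := by
    funext z
    rw [hW', Finset.sum_filter]
    refine Finset.sum_congr rfl fun p _ => ?_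
    split_ifs with hp
    · rw [packetProfile_of_isActive hp]
    · rw [packetProfile_of_not_isActive hp, Pi.zero_apply]
  have hsub := tsupport_finsetSum_subset W fun p => packetProfile R U p.1 p.2
  have hc : HasCompactSupport fun z => ∑ p ∈ W, packetProfile R U p.1 p.2 z :=
    (W.isCompact_biUnion fun p _ => hasCompactSupport_packetProfile hR).of_isClosed_subset
      (isClosed_tsupport _) hsub
  rw [lintegral_extOp_sq hS hφ (ContDiff.sum fun p _ => contDiff_packetProfile) hc
    (hsub.trans (iUnion₂_subset fun p _ => hsupp p.1 p.2))]
  simp_rw [fun z => congrFun e z]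
  refine (mul_le_mul_right (lintegral_sum_profile_sq_le hR W') _).trans ?_
  rw [← ENNReal.ofReal_mul (by positivity)]
  refine ENNReal.ofReal_le_ofReal ?_
  rw [mul_pow _ (Real.sqrt _), Real.sq_sqrt (by positivity)]
  have hcard : (W'.card : ℝ) ≤ W.card := by exact_mod_cast Finset.card_filter_le _ _
  -- Plancherel contributes `(2π)²` and almost orthogonality `(4π)²`, whose product is `(8π²)²`.
  calc (2 * Real.pi) ^ 2 * ((4 * Real.pi) ^ 2 * W'.card)
      ≤ (2 * Real.pi) ^ 2 * ((4 * Real.pi) ^ 2 * W.card) := by gcongr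
    _ = _ := by ring

theorem dsupport_packet_subset (hR : 0 < R) (hS : IsOpen S) (hφ : ContDiffOn ℝ ∞ φ S)
    {k l : Fin 2 → ℤ} (hsupp : tsupport (packetProfile R U k l) ⊆ S) :
    Distribution.dsupport
      (invFourierDist fun ξ τ => extOp S (fun _ => 1) φ (packetProfile R U k l) ξ τ) ⊆
      (fun z => (z, φ z)) '' {z | IsActive R U l ∧ z ∈ closedBox R (latticePoint R l)} :=
  (dsupport_extOp_subset hS hφ.continuousOn contDiff_packetProfile.continuous
    (hasCompactSupport_packetProfile hR) hsupp).trans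
    (image_mono fun _ hz => mem_tsupport_packetProfile hz)

/-- On the convex ball the phase is Lipschitz with constant `m = max 1 G`. The squared distance is
at most `2m² · 9/8 · R⁻² < (2m/R)²`; taking `m ≥ 1` absorbs the horizontal part. -/
theorem mem_ball3_of_mem_closedBox (hR : 0 < R) (hS : IsOpen S) (hφ : ContDiffOn ℝ ∞ φ S)
    {v z : Plane} (hv : ball v (2 / R) ⊆ S) {G : ℝ} (hG : ∀ z ∈ S, ‖fderiv ℝ φ z‖ ≤ G)
    (hz : z ∈ closedBox R v) : (z, φ z) ∈ ball3 v (φ v) (2 * max 1 G / R) := by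
  have hm : 1 ≤ max 1 G := le_max_left _ _
  set m := max 1 G with hmdef
  have h1 : ‖φ z - φ v‖ ≤ m * ‖z - v‖ :=
    (convex_ball v (2 / R)).norm_image_sub_le_of_norm_fderiv_le
      (fun x hx => differentiableAt_of_contDiffOn hS hφ (hv hx))
      (fun x hx => (hG x (hv hx)).trans (le_max_right _ _))
      (mem_ball_self (by positivity)) (closedBox_subset_ball hR hz)
  have h2 := norm_sub_sq_le hR hz
  have h3 : (φ z - φ v) ^ 2 ≤ m ^ 2 * ‖z - v‖ ^ 2 := by
    rw [← mul_pow, ← sq_abs (φ z - φ v)]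
    exact pow_le_pow_left₀ (abs_nonneg _) h1 2
  change Real.sqrt (‖z - v‖ ^ 2 + (φ z - φ v) ^ 2) < 2 * m / R
  rw [Real.sqrt_lt' (by positivity)]
  have h4 : (2 * m / R) ^ 2 = 4 * m ^ 2 * (1 / R) ^ 2 := by ring
  have h5 : 2 * (3 / 4 / R) ^ 2 = 9 / 8 * (1 / R) ^ 2 := by ring
  have h6 : 0 < (1 / R) ^ 2 := by positivity
  have h7 : (1 : ℝ) ≤ m ^ 2 := one_le_pow₀ hm
  rw [h4]
  rw [h5] at h2
  calc ‖z - v‖ ^ 2 + (φ z - φ v) ^ 2 ≤ ‖z - v‖ ^ 2 + m ^ 2 * ‖z - v‖ ^ 2 := by gcongr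
    _ ≤ m ^ 2 * ‖z - v‖ ^ 2 + m ^ 2 * ‖z - v‖ ^ 2 := by nlinarith [sq_nonneg ‖z - v‖]
    _ = 2 * m ^ 2 * ‖z - v‖ ^ 2 := by ring
    _ ≤ 2 * m ^ 2 * (9 / 8 * (1 / R) ^ 2) := by gcongr
    _ < 4 * m ^ 2 * (1 / R) ^ 2 := by nlinarith [mul_pos (by positivity : 0 < m ^ 2) h6]

end PacketIndex

/-! ### Assembly of the properties -/

theorem lemma4p2 (α : Plane → ℂ) (hα : ContDiff ℝ ∞ α) (hαc : HasCompactSupport α) (C₀ : ℝ) :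
    ∃ C : ℝ, 0 < C ∧
      ∀ (δ κ A R : ℝ) (U U' : Set Plane) (φ : Plane → ℝ),
        0 < δ → 1 ≤ κ → 4 ≤ A → 1 / δ ≤ R →
        IsOpen U → Bornology.IsBounded U → U' = thickening (A * δ) U →
        ContDiffOn ℝ ∞ φ U' →
        (∀ z ∈ U', κ ≤ C₀ * hessianNorm φ z ∧ hessianNorm φ z ≤ C₀ * κ) →
        (∀ j k : ℕ, k ≤ 3 → 2 ≤ j + k → ∀ z ∈ U',
          |mixedPartial j k φ z| ≤ C₀ * ((δ * κ) ^ (3 - k - j : ℤ) * δ⁻¹)) →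
        (∀ z ∈ U', mixedPartial 2 0 φ z = 0) →
        ∀ f : Plane → ℂ, MemLp f 2 (volume.restrict U) →
          ∃ (p : packetIndex R U' → Plane → ℝ → ℂ) (c : packetIndex R U' → ℂ),
            -- the decomposition of the extension of `f`
            (∀ (ξ : Plane) (τ : ℝ), |τ| ≤ R ^ 2 / κ →
              HasSum (fun w => c w * p w ξ τ) (extOp U α φ f ξ τ)) ∧
            -- (P1) each packet is the extension of the inverse transform of its initial value
            (∀ (w : packetIndex R U') (ξ : Plane) (τ : ℝ),
              p w ξ τ = extOp U' (fun _ => 1) φ (invFourierPlane (fun ζ => p w ζ 0)) ξ τ) ∧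
            -- (P2) frequency localisation, first in `z ∈ ℝ²` and then in `(z, s) ∈ ℝ² × ℝ`
            (∀ w : packetIndex R U',
              Distribution.dsupport (invFourierDist (p w)) ⊆ ball w.1.2 (2 / R) ×ˢ univ) ∧
            (∀ G : ℝ, (∀ z ∈ U', ‖fderiv ℝ φ z‖ ≤ G) → ∀ w : packetIndex R U',
              Distribution.dsupport (invFourierDist (p w)) ⊆
                ball3 w.1.2 (φ w.1.2) (2 * max 1 G / R)) ∧
            -- (P3) decay away from the tube, and the resulting bound for the `L²` norm
            (∀ (w : packetIndex R U') (ξ : Plane) (τ : ℝ), |τ| ≤ R ^ 2 / κ →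
              ‖p w ξ τ‖ ≤ C * R⁻¹ * ((1 + |tubeOffset φ w ξ τ 0| / R) ^ 2)⁻¹ *
                ((1 + |tubeOffset φ w ξ τ 1| / R) ^ 2)⁻¹) ∧
            (∀ (w : packetIndex R U') (τ : ℝ),
              eLpNorm (fun ξ => p w ξ τ) 2 volume ≤ ENNReal.ofReal C) ∧
            -- (P4) orthogonality
            (∀ (W : Finset (packetIndex R U')) (τ : ℝ),
              eLpNorm (fun ξ => ∑ w ∈ W, p w ξ τ) 2 volume ≤
                ENNReal.ofReal (C * Real.sqrt (W.card : ℝ))) ∧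
            -- (P5) the coefficients are controlled in `ℓ²`
            (∑' w : packetIndex R U', ‖c w‖ₑ ^ 2) ^ (1 / 2 : ℝ) ≤
              ENNReal.ofReal C * eLpNorm f 2 (volume.restrict U) := by
  obtain ⟨Cd, hCd, hdecay⟩ := exists_profile_decay (abs_nonneg C₀)
  obtain ⟨M, hM⟩ := hα.continuous.bounded_above_of_compact_support hαc
  have hM0 : 0 ≤ M := (norm_nonneg _).trans (hM 0)
  -- One constant dominates all needs: `Cd` for the pointwise decay, `8π²` for the `L²` bounds, and
  -- `M`, the bound of the amplitude, for the coefficients.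
  set C : ℝ := Cd + 8 * Real.pi ^ 2 + M with hC
  have hpi : 0 < Real.pi ^ 2 := by positivity
  refine ⟨C, by positivity, ?_⟩
  intro δ κ A R U U' φ hδ hκ hA hδR hU hUb hU' hφ _ hmix h20 f hf
  have hR : 0 < R := lt_of_lt_of_le (by positivity) hδR
  have hκ0 : 0 < κ := by linarith
  have hS : IsOpen U' := hU' ▸ isOpen_thickening
  have hball : ∀ l, IsActive R U l → ball (latticePoint R l) (2 / R) ⊆ U' := fun l hl =>
    hU' ▸ hl.ball_subset hR hδ hA hδR
  have hact : ∀ l, IsActive R U l → closedBox R (latticePoint R l) ⊆ U' := fun l hl =>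
    (closedBox_subset_ball hR).trans (hball l hl)
  have hsupp : ∀ k l, tsupport (packetProfile R U k l) ⊆ U' := fun k l =>
    hU' ▸ tsupport_packetProfile_subset hR hδ hA hδR
  set h : Plane → ℂ := U.indicator fun z => f z * α z with hh
  have hfM : ∀ z, ‖f z * α z‖ ≤ M * ‖f z‖ := fun z => by
    rw [norm_mul, mul_comm]
    exact mul_le_mul_of_nonneg_right (hM z) (norm_nonneg _)
  have hfα : MemLp (fun z => f z * α z) 2 (volume.restrict U) :=
    hf.of_le_mul (hf.1.mul hα.continuous.aestronglyMeasurable) (ae_of_all _ hfM)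
  have hhL : MemLp h 2 := (memLp_indicator_iff_restrict hU.measurableSet).2 hfα
  have hhU : ∀ z ∉ U, h z = 0 := fun z hz => indicator_of_notMem hz _
  obtain ⟨ι, hιinj, hι, hιrange⟩ := exists_packetIndex_coords hR U'
  have hext : ∀ ξ τ, extOp U α φ f ξ τ = ∫ z, h z *
      Complex.exp (-(Complex.I * ((ξ 0 * z 0 + ξ 1 * z 1 + τ * φ z : ℝ) : ℂ))) := fun ξ τ => by
    rw [extOp, ← integral_indicator hU.measurableSet]
    refine integral_congr_ae (ae_of_all _ fun z => ?_)
    by_cases hz : z ∈ U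
    · simp only [hh, indicator_of_mem hz]
      ring
    · simp only [hh, indicator_of_notMem hz, zero_mul]
  have hinactive : ∀ l, latticePoint R l ∉ U' → ¬IsActive R U l := fun l hl hl' =>
    hl (hball l hl' (mem_ball_self (by positivity)))
  have horth : ∀ (W : Finset (packetIndex R U')) (τ : ℝ),
      eLpNorm (fun ξ => ∑ w ∈ W, extOp U' (fun _ => 1) φ
        (packetProfile R U (ι w).1 (ι w).2) ξ τ) 2 volume ≤
        ENNReal.ofReal (C * Real.sqrt (W.card : ℝ)) := fun W τ => by
    have := eLpNorm_sum_packet_le hR hS hφ hsupp (W.map ⟨ι, hιinj⟩) τ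
    simp only [Finset.sum_map, Finset.card_map, Function.Embedding.coeFn_mk] at this
    refine this.trans (ENNReal.ofReal_le_ofReal ?_)
    gcongr
    linarith
  refine ⟨fun w ξ τ => extOp U' (fun _ => 1) φ (packetProfile R U (ι w).1 (ι w).2) ξ τ,
    fun w => packetCoeff R h (ι w).1 (ι w).2, ?_, ?_, ?_, ?_, ?_, ?_, horth, ?_⟩
  · intro ξ τ _
    rw [hext]
    -- Pairs outside the range of `ι` have their lattice point outside `U'`, so they are inactive
    -- and contribute zero.
    refine (hιinj.hasSum_iff fun p hp => ?_).2 (hasSum_packet hR hUb hS hφ hact hhL hhU ξ τ)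
    have := hinactive p.2 fun hp' => hp (hιrange p.1 p.2 hp')
    rw [packetProfile_of_not_isActive this]
    simp [extOp]
  · intro w ξ τ
    rw [invFourierPlane_extOp contDiff_packetProfile (hasCompactSupport_packetProfile hR)
      (hsupp _ _)]
  · intro w
    refine (dsupport_packet_subset hR hS hφ (hsupp _ _)).trans ?_
    rintro _ ⟨z, ⟨-, hz⟩, rfl⟩
    refine ⟨?_, mem_univ _⟩
    rw [(hι w).2]
    exact closedBox_subset_ball hR hz
  · intro G hG w
    refine (dsupport_packet_subset hR hS hφ (hsupp _ _)).trans ?_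
    rintro _ ⟨z, ⟨hl, hz⟩, rfl⟩
    rw [(hι w).2]
    exact mem_ball3_of_mem_closedBox hR hS hφ (hball _ hl) hG hz
  · intro w ξ τ hτ
    change ‖extOp U' (fun _ => 1) φ (packetProfile R U (ι w).1 (ι w).2) ξ τ‖ ≤ _
    by_cases hl : IsActive R U (ι w).2
    · have hb : ∀ j k : ℕ, k ≤ 3 → 2 ≤ j + k → ∀ z ∈ U',
          |mixedPartial j k φ z| ≤ |C₀| * ((δ * κ) ^ (3 - k - j : ℤ) * δ⁻¹) :=
        fun j k hk hjk z hz => (hmix j k hk hjk z hz).trans (by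
          gcongr
          exact le_abs_self C₀)
      -- Second derivatives have exponent one, which gives `κ`; third derivatives have exponent
      -- zero, which gives `δ⁻¹`.
      have hone : (δ * κ) ^ (1 : ℤ) * δ⁻¹ = κ := by
        rw [zpow_one]
        field_simp
      have key := hdecay δ κ R τ U' φ (latticePoint R (ι w).2) ξ (ι w).1 hδ hκ hδR hS hφ
        (hact _ hl) (fun z hz => (hb 0 2 (by norm_num) (by norm_num) z hz).trans_eq
          (by norm_num; left; simpa using hone))
        (fun z hz => (hb 1 1 (by norm_num) (by norm_num) z hz).trans_eq
          (by norm_num; left; simpa using hone))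
        (fun z hz => (hb 1 2 (by norm_num) (by norm_num) z hz).trans_eq (by norm_num)) h20 hτ
      rw [packetProfile_of_isActive hl]
      have habs : ∀ x : ℝ, |x| / R = |x / R| := fun x => by rw [abs_div, abs_of_pos hR]
      simp only [tubeOffset, (hι w).1, (hι w).2, habs]
      refine key.trans ?_
      gcongr
      linarith
    · have h0 : extOp U' (fun _ => 1) φ (packetProfile R U (ι w).1 (ι w).2) ξ τ = 0 := by
        rw [packetProfile_of_not_isActive hl]
        simp [extOp]
      rw [h0, norm_zero]
      positivity
  · intro w τ
    simpa using horth {w} τ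
  · have h1 : ∑' w : packetIndex R U', ‖packetCoeff R h (ι w).1 (ι w).2‖ₑ ^ 2 ≤
        ∫⁻ z, ‖h z‖ₑ ^ 2 :=
      (ENNReal.tsum_comp_le_tsum_of_injective hιinj
        fun p => ‖packetCoeff R h p.1 p.2‖ₑ ^ 2).trans (tsum_packetCoeff_le hR hhL)
    refine (ENNReal.rpow_le_rpow h1 (by norm_num)).trans ?_
    rw [← eLpNorm_two_eq, hh, eLpNorm_indicator_eq_eLpNorm_restrict hU.measurableSet]
    refine (eLpNorm_le_mul_eLpNorm_of_ae_le_mul (ae_of_all _ hfM) 2).trans ?_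
    gcongr
    linarith
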